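/- **Schenzel's formula.** Let $\mathbb{k}$ be an infinite field and let $\Psi=(\Delta,\Gamma)$ be a relative simplicial complex, i.e. $\Delta$ is a simplicial complex on a finite ground set and $\Gamma\subseteq\Delta$ is a (possibly void) subcomplex; the faces of $\Psi$ are the elements of $\Delta\setminus\Gamma$, and $\emptyset$ counts as a face, of dimension $-1$, of every non-void complex. Let $I_\Delta$, $I_\Gamma$ be the non-face ideals in the polynomial ring on the vertices of $\Delta$, let $\mathbb{k}[\Delta]=\mathbb{k}[x_v]/I_\Delta$ be the face ring, and let $\mathbb{k}[\Psi]=I_\Gamma/I_\Delta$ be the relative face module. A graded module $M$ is Cohen–Macaulay if it is zero or some homogeneous system of parameters of $M$ (a sequence $\Phi$ of homogeneous elements of positive degree, of minimal length such that $\dim_{\mathbb{k}}M/\langle\Phi\rangle M<\infty$) is an $M$-sequence. Suppose $\Psi$ is a Buchsbaum complex of dimension $d$: $\Psi$ has a face, all its maximal faces have dimension $d$, and for every nonempty $\tau\in\Delta$ the face module $\mathbb{k}[\mathrm{st}_\tau\Psi]$ of the star $\mathrm{st}_\tau\Psi=(\mathrm{st}_\tau\Delta,\mathrm{st}_\tau\Gamma)$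 is Cohen–Macaulay, where $\mathrm{st}_\tau\Delta=\{\rho\in\Delta:\tau\cup\rho\in\Delta\}$ and likewise for $\Gamma$. Then a generic sequence $\Theta=(\theta_1,\dots,\theta_{d+1})$ of elements of $\mathbb{k}[\Delta]_1$ (that is, every $\Theta$ in some nonempty Zariski open subset of $\mathbb{k}[\Delta]_1^{\,d+1}$) is a linear system of parameters for $\mathbb{k}[\Psi]$ and satisfies, for all $j\ge 0$, $$\dim_{\mathbb{k}}\bigl(\mathbb{k}[\Psi]/\langle\Theta\rangle\mathbb{k}[\Psi]\bigr)_j \;=\; h_j(\Psi)+\binom{d+1}{j}\sum_{i=0}^{j-2}(-1)^{i+j}\dim_{\mathbb{k}}H^i(\Psi;\mathbb{k}).$$ Here $H^i(\Psi;\mathbb{k})$ is the simplicial cohomology of the pair $(\Delta,\Gamma)$ computed with $\emptyset$ as a face of dimension $-1$ (reduced cohomology of $\Delta$ if $\Gamma$ is void), and $h_j(\Psi)$ is the coefficient of $x^j$ in $\sum_{i=-1}^{d}f_i(\Psi)\,x^{i+1}(1-x)^{d-i}$, where $f_i(\Psi)$ is the number of $i$-dimensional faces of $\Psi$. -/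

import Mathlib

open MvPolynomial

noncomputable section

namespace StanleyReisner

variable {V : Type*}

/-- A simplicial complex on the ground set `V`: a downward closed family of finite subsets of `V`.
The void complex `⊥` (no face at all) and the complex `{∅}` are different complexes. -/
abbrev Complex (V : Type*) : Type _ := LowerSet (Finset V)

/-- The vertices of a complex. -/
abbrev Complex.Vertex (Δ : Complex V) : Type _ := {v : V // ({v} : Finset V) ∈ Δ}

/-- The star `{ρ ∈ Δ | τ ∪ ρ ∈ Δ}` of `τ` in `Δ`; it is void if `τ` is not a face of `Δ`. -/
def Complex.star [DecidableEq V] (Δ : Complex V) (τ : Finset V) : Complex V where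
  carrier := {ρ | ρ ∈ Δ ∧ τ ∪ ρ ∈ Δ}
  lower' := fun _ _ hab ha =>
    ⟨Δ.lower hab ha.1, Δ.lower (Finset.union_subset_union_right hab) ha.2⟩

/-- A relative simplicial complex `Ψ = (Δ, Γ)`: a complex with a subcomplex. -/
structure RelComplex (V : Type*) where
  Δ : Complex V
  Γ : Complex V
  le : Γ ≤ Δ

namespace RelComplex

/-- The faces of `(Δ, Γ)` are the faces of `Δ` that are not faces of `Γ`. -/
def faces (Ψ : RelComplex V) : Set (Finset V) := {σ | σ ∈ Ψ.Δ ∧ σ ∉ Ψ.Γ}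

/-- The star of `τ` in `(Δ, Γ)` is the pair of the stars of `τ` in `Δ` and in `Γ`. -/
def star [DecidableEq V] (Ψ : RelComplex V) (τ : Finset V) : RelComplex V where
  Δ := Ψ.Δ.star τ
  Γ := Ψ.Γ.star τ
  le := fun _ h => ⟨Ψ.le h.1, Ψ.le h.2⟩

/-- `Ψ` has a face and all its maximal faces have `n` elements, i.e. `Ψ` is pure of dimension
`d = n - 1`. -/
def IsPure (Ψ : RelComplex V) (n : ℕ) : Prop :=
  Ψ.faces.Nonempty ∧ ∀ σ, Maximal (· ∈ Ψ.faces) σ → σ.card = n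

/-- The number of faces with `m` elements, i.e. the face number `f_{m-1}(Ψ)`. -/
def fNum (Ψ : RelComplex V) (m : ℕ) : ℕ := {σ | σ ∈ Ψ.faces ∧ σ.card = m}.ncard

/-- The polynomial `∑_{i=-1}^{d} f_i(Ψ) x^{i+1} (1-x)^{d-i}`, where `n = d + 1`. -/
def hPoly (Ψ : RelComplex V) (n : ℕ) : Polynomial ℤ :=
  ∑ m ∈ Finset.range (n + 1),
    (Ψ.fNum m : Polynomial ℤ) * Polynomial.X ^ m * (1 - Polynomial.X) ^ (n - m)

/-- The entry `h_j(Ψ)` of the `h`-vector of a relative complex of dimension `d = n - 1`. -/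
def hNum (Ψ : RelComplex V) (n j : ℕ) : ℤ := (Ψ.hPoly n).coeff j

end RelComplex

/-! ### Simplicial cohomology of a pair, with the empty set as a face of dimension `-1` -/

section Cohomology

variable [LinearOrder V] (k : Type*) [Field k] (Ψ : RelComplex V)

/-- Simplicial cochains of the pair on the faces with `m` elements (cochains of degree `m - 1`). -/
abbrev Cochain (m : ℕ) : Type _ := {σ : Finset V // σ ∈ Ψ.faces ∧ σ.card = m} → k

open Classical in
/-- The value of a cochain at a finite set: it is zero off the faces of `Ψ`. -/
def Cochain.val {k : Type*} [Field k] {Ψ : RelComplex V} {m : ℕ} (f : Cochain k Ψ m)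
    (σ : Finset V) : k :=
  if h : σ ∈ Ψ.faces ∧ σ.card = m then f ⟨σ, h⟩ else 0

/-- The sign of the face `τ \ {v}` of `τ`, for the orientation given by the order of `V`. -/
def faceSign (τ : Finset V) (v : V) : k := (-1) ^ (τ.filter (· < v)).card

/-- The simplicial coboundary. -/
def coboundary (m : ℕ) : Cochain k Ψ m →ₗ[k] Cochain k Ψ (m + 1) where
  toFun f := fun τ => ∑ v ∈ τ.1, faceSign k τ.1 v * f.val (τ.1.erase v)
  map_add' f g := by
    funext τ
    simp only [Pi.add_apply, ← Finset.sum_add_distrib, ← mul_add]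
    refine Finset.sum_congr rfl fun v _ => ?_
    congr 1
    unfold Cochain.val
    split_ifs <;> simp
  map_smul' c f := by
    funext τ
    simp only [Pi.smul_apply, smul_eq_mul, RingHom.id_apply, Finset.mul_sum]
    refine Finset.sum_congr rfl fun v _ => ?_
    unfold Cochain.val
    split_ifs <;> simp [mul_left_comm]

/-- The cohomology `H^i(Ψ; k)` for `i ≥ 0`. It is the reduced cohomology of `Δ` when `Γ` is
void. -/
abbrev cohomology (i : ℕ) : Type _ :=
  LinearMap.ker (coboundary k Ψ (i + 1)) ⧸
    (LinearMap.range (coboundary k Ψ i)).submoduleOf (LinearMap.ker (coboundary k Ψ (i + 1)))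

end Cohomology

/-! ### Face modules -/

section FaceModule

variable (k : Type*) [Field k]

/-- The non-face ideal `I_Δ`. All elements of the ground set are used as variables; the variables
that are not vertices of `Δ` lie in `I_Δ`. -/
def nonfaceIdeal (Δ : Complex V) : Ideal (MvPolynomial V k) :=
  Ideal.span {f | ∃ σ : Finset V, σ ∉ Δ ∧ f = ∏ v ∈ σ, X v}

/-- The relative face module `k[Ψ] = I_Γ / I_Δ`. It is regarded as a module over the polynomial
ring, which acts through its graded quotient `k[Δ]`. -/
abbrev FaceModule (Ψ : RelComplex V) : Type _ :=
  nonfaceIdeal k Ψ.Γ ⧸ (nonfaceIdeal k Ψ.Δ).submoduleOf (nonfaceIdeal k Ψ.Γ)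

/-- The graded piece `k[Ψ]_j`. -/
def faceModuleDeg (Ψ : RelComplex V) (j : ℕ) : Submodule k (FaceModule k Ψ) :=
  ((homogeneousSubmodule V k j).comap
      ((nonfaceIdeal k Ψ.Γ).subtype.restrictScalars k)).map
    (((nonfaceIdeal k Ψ.Δ).submoduleOf (nonfaceIdeal k Ψ.Γ)).mkQ.restrictScalars k)

variable {k}

/-- `M / ⟨Θ⟩ M`. -/
abbrev QuotientBy (M : Type*) [AddCommGroup M] [Module (MvPolynomial V k) M]
    (Θ : List (MvPolynomial V k)) : Type _ :=
  M ⧸ (Ideal.ofList Θ • ⊤ : Submodule (MvPolynomial V k) M)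

/-- The graded piece `(k[Ψ]/⟨Θ⟩)_j`. -/
def reducedDeg (Ψ : RelComplex V) (Θ : List (MvPolynomial V k)) (j : ℕ) :
    Submodule k (QuotientBy (FaceModule k Ψ) Θ) :=
  (faceModuleDeg k Ψ j).map
    ((Ideal.ofList Θ • ⊤ : Submodule (MvPolynomial V k) (FaceModule k Ψ)).mkQ.restrictScalars k)

variable (k) in
/-- A homogeneous system of parameters: a sequence of homogeneous elements of positive degree, of
minimal length among those with `M / ⟨Θ⟩ M` finite dimensional over `k`. -/
structure IsHSOP (M : Type*) [AddCommGroup M] [Module k M] [Module (MvPolynomial V k) M]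
    [IsScalarTower k (MvPolynomial V k) M] (Θ : List (MvPolynomial V k)) : Prop where
  homogeneous : ∀ θ ∈ Θ, ∃ e, 0 < e ∧ θ.IsHomogeneous e
  finite : Module.Finite k (QuotientBy M Θ)
  minimal : ∀ Φ : List (MvPolynomial V k), (∀ φ ∈ Φ, ∃ e, 0 < e ∧ φ.IsHomogeneous e) →
    Module.Finite k (QuotientBy M Φ) → Θ.length ≤ Φ.length

variable (k) in
/-- A linear system of parameters. -/
def IsLSOP (M : Type*) [AddCommGroup M] [Module k M] [Module (MvPolynomial V k) M]
    [IsScalarTower k (MvPolynomial V k) M] (Θ : List (MvPolynomial V k)) : Prop :=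
  IsHSOP k M Θ ∧ ∀ θ ∈ Θ, θ.IsHomogeneous 1

variable (k) in
/-- `M` is Cohen-Macaulay: some homogeneous system of parameters is an `M`-sequence. As usual the
zero module counts as Cohen-Macaulay. -/
def IsCohenMacaulay (M : Type*) [AddCommGroup M] [Module k M] [Module (MvPolynomial V k) M]
    [IsScalarTower k (MvPolynomial V k) M] : Prop :=
  Subsingleton M ∨
    ∃ Θ : List (MvPolynomial V k), IsHSOP k M Θ ∧ RingTheory.Sequence.IsRegular M Θ

variable (k) in
/-- `Ψ` is a Buchsbaum complex over `k`, of dimension `d = n - 1`: it is pure of dimension `d` and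
the star of each nonempty face of `Δ` is Cohen-Macaulay. -/
def IsBuchsbaum [DecidableEq V] (Ψ : RelComplex V) (n : ℕ) : Prop :=
  Ψ.IsPure n ∧ ∀ τ ∈ Ψ.Δ, τ.Nonempty → IsCohenMacaulay (V := V) k (FaceModule k (Ψ.star τ))

open Classical in
/-- The sequence of `n` linear forms `∑_v c (i, v) x_v` in the vertices of `Δ`. -/
def linearForms [Fintype V] (Δ : Complex V) (n : ℕ) (c : Fin n × Δ.Vertex → k) :
    List (MvPolynomial V k) :=
  List.ofFn fun i : Fin n => ∑ v : Δ.Vertex, C (c (i, v)) * X v.1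

variable (k) in
/-- A generic sequence `Θ` of `n` elements of `k[Δ]_1` satisfies `P`: there is a nonzero polynomial
in the coefficients of `Θ` such that `P Θ` holds wherever it does not vanish. That is, `P` holds on
a nonempty (equivalently, dense) Zariski open subset of the affine space of all such `Θ`. -/
def ForGeneric [Fintype V] (Δ : Complex V) (n : ℕ) (P : List (MvPolynomial V k) → Prop) : Prop :=
  ∃ p : MvPolynomial (Fin n × Δ.Vertex) k, p ≠ 0 ∧
    ∀ c : Fin n × Δ.Vertex → k, eval c p ≠ 0 → P (linearForms Δ n c)

end FaceModule

end StanleyReisner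

end

/-! The proof uses the partition complex: put `k[st_τ Ψ]` in position `|τ|` for every finite set
`τ`, with the simplicial coboundary. Position 0 is `k[Ψ]` itself. Contraction with a vertex `v` is a
cone homotopy (`polyCoboundary_contraction_add`). It respects the face ideals on monomials divisible
by `x_v`, and on all monomials after multiplication by `x_v`. Hence the complex has no cohomology in
positive polynomial degree (`relBetti_nonfaceIdeal_of_pos`), and linear forms act as zero on
cohomology even after reduction modulo parameters (`smul_mem_relCoboundaries`). In polynomial degree
0, position `i + 1` computes `H^i(Ψ)` (`relBetti_nonfaceIdeal_zero`).

Now divide by the `n = d + 1` forms of `Θ` one at a time. For nonempty `τ` the module `k[st_τ Ψ]` is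
zero or Cohen–Macaulay with `n` parameters, and `Θ` is regular on it, so a parameter can fail to be
injective only in position 0. The long exact sequence of multiplication by the next form breaks up,
and the Betti numbers after `r` steps satisfy `b_{r+1}(i,j) = b_r(i,j) + b_r(i+1,j-1)`, whence
`b_r(i,j) = C(r,j) b_0(i+j,0)`. In position 0 the kernel of the next form is exactly the cohomology
there, so the Hilbert function satisfies `F_{r+1}(j) = F_r(j) - F_r(j-1) + b_r(0,j-1)`. Solving this
recursion gives the coefficients of `(1-x)^n Hilb(k[Ψ])`, which are the `h`-numbers, plus the
alternating sum (`relBetti_and_finrank_of_isParameterStep`).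

Two inputs remain. Cohen–Macaulayness supplies only some regular system of parameters; localization
at the irrelevant ideal and a depth argument transfer regularity to `Θ`
(`IsLocalRing.isWeaklyRegular_of_support_subset`, `IsHSOP.mem_relIdeal_of_mul_mem`). Genericity
means that the minors of the coefficient matrix indexed by facets do not vanish; since facets of
stars are facets of `Ψ`, one condition serves all stars. -/

section LocalDepth

-- Depth and systems of parameters over a Noetherian local ring.

universe u

open RingTheory.Sequence IsLocalRing Module CategoryTheory Abelian PrimeSpectrum Pointwise

variable {R : Type u} [CommRing R] [IsLocalRing R] [IsNoetherianRing R]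

/-- A nonzero submodule of a module of depth at least `n` has dimension at least `n`. -/
theorem IsLocalRing.length_le_supportDim_of_isWeaklyRegular (rs : List R)
    (hm : ∀ r ∈ rs, r ∈ maximalIdeal R) (N : Type u) [AddCommGroup N] [Module R N]
    [Module.Finite R N] (hrs : IsWeaklyRegular N rs) (L : Submodule R N) (hL : L ≠ ⊥) :
    (rs.length : WithBot ℕ∞) ≤ supportDim R L := by
  induction rs generalizing N with
  | nil =>
    have : Nontrivial L := (Submodule.nontrivial_iff_ne_bot).2 hL
    have : supportDim R L ≠ ⊥ := supportDim_ne_bot_of_nontrivial R L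
    obtain ⟨x, hx⟩ := WithBot.ne_bot_iff_exists.1 this
    rw [← hx]
    simp only [List.length_nil, CharP.cast_eq_zero]
    exact WithBot.coe_le_coe.2 (zero_le)
  | cons a rs ih =>
    rw [isWeaklyRegular_cons_iff] at hrs
    obtain ⟨ha, hrs⟩ := hrs
    have ham : a ∈ maximalIdeal R := hm a (by simp)
    -- The chain of all `x` with `a ^ k • x ∈ L` stabilizes at the saturation `K` of `L`.
    -- Multiplication by `a ^ k` embeds `K` in `L`, so it suffices to bound the dimension of `K`.
    let S : ℕ →o Submodule R N := ⟨fun k => L.comap (LinearMap.lsmul R N (a ^ k)), by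
      refine monotone_nat_of_le_succ fun k x hx => ?_
      simp only [Submodule.mem_comap, LinearMap.lsmul_apply] at hx ⊢
      rw [pow_succ', mul_smul]
      exact L.smul_mem a hx⟩
    obtain ⟨k, hk⟩ := monotone_stabilizes_iff_noetherian.2
      (inferInstance : IsNoetherian R N) S
    let K : Submodule R N := S k
    have hKmem : ∀ x, x ∈ K ↔ a ^ k • x ∈ L := fun x => Iff.rfl
    have hLK : L ≤ K := fun x hx => (hKmem x).2 (L.smul_mem _ hx)
    have hdimKL : supportDim R K ≤ supportDim R L := by
      let f : K →ₗ[R] L := ((LinearMap.lsmul R N (a ^ k)).comp K.subtype).codRestrict L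
        fun x => (hKmem x).1 x.2
      refine supportDim_le_of_injective f fun x y hxy => ?_
      have := congrArg Subtype.val hxy
      exact Subtype.ext ((ha.pow k) this)
    have : Nontrivial K := (Submodule.nontrivial_iff_ne_bot).2
      (ne_bot_of_le_ne_bot hL hLK)
    have hKreg : IsSMulRegular K a := fun x y hxy => Subtype.ext (ha (congrArg Subtype.val hxy))
    let g : QuotSMulTop a K →ₗ[R] QuotSMulTop a N := QuotSMulTop.map a K.subtype
    -- Saturation gives `K ∩ aN = aK`: if `a • y ∈ K`, then `a ^ (k + 1) • y ∈ L`, so `y ∈ K`. Thus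
    -- `K / aK` is a nonzero submodule of `N / aN`, and induction applies.
    have hg : Function.Injective g := by
      rw [injective_iff_map_eq_zero]
      intro x hx
      obtain ⟨x, rfl⟩ := Submodule.Quotient.mk_surjective _ x
      have hx' : (x : N) ∈ a • (⊤ : Submodule R N) := by
        have : g (Submodule.Quotient.mk x) = Submodule.Quotient.mk (x : N) := rfl
        rw [this, Submodule.Quotient.mk_eq_zero] at hx
        exact hx
      obtain ⟨y, -, hy⟩ := (Submodule.mem_smul_pointwise_iff_exists _ _ _).1 hx'
      rw [Submodule.Quotient.mk_eq_zero]
      have hyK : y ∈ K := by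
        have h1 : y ∈ S (k + 1) := by
          change a ^ (k + 1) • y ∈ L
          rw [pow_succ, mul_smul, hy]
          exact (hKmem _).1 x.2
        have := hk (k + 1) (Nat.le_succ k)
        rw [← this] at h1
        exact h1
      exact (Submodule.mem_smul_pointwise_iff_exists _ _ _).2 ⟨⟨y, hyK⟩, trivial, Subtype.ext hy⟩
    have hnt : Nontrivial (QuotSMulTop a K) := nontrivial_quotSMulTop_of_mem_maximalIdeal _ ham
    have h1 := ih (fun r hr => hm r (by simp [hr])) (QuotSMulTop a N) hrs (LinearMap.range g) (by
      intro h
      rw [LinearMap.range_eq_bot] at h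
      obtain ⟨x, hx⟩ := exists_ne (0 : QuotSMulTop a K)
      exact hx (hg (by simp [h])))
    rw [← supportDim_eq_of_equiv (LinearEquiv.ofInjective g hg)] at h1
    calc ((a :: rs).length : WithBot ℕ∞) = rs.length + 1 := by simp
      _ ≤ supportDim R (QuotSMulTop a K) + 1 := by gcongr
      _ = supportDim R K := supportDim_quotSMulTop_succ_eq_supportDim hKreg ham
      _ ≤ _ := hdimKL

theorem IsLocalRing.supportDim_le_supportDim_quotient_ofList_add_length (rs : List R)
    (hm : ∀ r ∈ rs, r ∈ maximalIdeal R) (N : Type u) [AddCommGroup N] [Module R N]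
    [Module.Finite R N] :
    supportDim R N ≤ supportDim R (N ⧸ (Ideal.ofList rs • ⊤ : Submodule R N)) + rs.length := by
  induction rs generalizing N with
  | nil =>
    rw [supportDim_eq_of_equiv (Submodule.quotEquivOfEqBot
      (Ideal.ofList ([] : List R) • ⊤ : Submodule R N) (by simp))]
    simp
  | cons a rs ih =>
    have h1 := supportDim_le_supportDim_quotSMulTop_succ (M := N) (hm a (by simp))
    have h2 := ih (fun r hr => hm r (by simp [hr])) (QuotSMulTop a N)
    rw [supportDim_eq_of_equiv (Submodule.quotOfListConsSMulTopEquivQuotSMulTopInner N a rs)]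
    refine h1.trans ((add_le_add_left h2 1).trans (le_of_eq ?_))
    simp [add_assoc]

/-- Dividing by a regular element of the maximal ideal lowers the depth by at most one. -/
theorem IsLocalRing.exists_isWeaklyRegular_quotSMulTop (rs : List R)
    (hm : ∀ r ∈ rs, r ∈ maximalIdeal R) (N : Type u) [AddCommGroup N] [Module R N]
    [Module.Finite R N] (hrs : IsWeaklyRegular N rs) {x : R} (hxm : x ∈ maximalIdeal R)
    (hx : IsSMulRegular N x) :
    ∃ ss : List R, ss.length = rs.length - 1 ∧ (∀ r ∈ ss, r ∈ maximalIdeal R) ∧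
      IsWeaklyRegular (QuotSMulTop x N) ss := by
  cases subsingleton_or_nontrivial N with
  | inl h =>
    refine ⟨List.replicate (rs.length - 1) 0, by simp, ?_, ?_⟩
    · intro r hr
      rw [List.eq_of_mem_replicate hr]
      exact zero_mem _
    · constructor
      intro i hi a b _
      have : Subsingleton (QuotSMulTop x N) := (Submodule.Quotient.mk_surjective _).subsingleton
      exact ((Submodule.Quotient.mk_surjective _).subsingleton).elim _ _
  | inr h =>
    have nak : ∀ (N' : Type u) [AddCommGroup N'] [Module R N'] [Module.Finite R N']
        [Nontrivial N'], (maximalIdeal R) • (⊤ : Submodule R N') < ⊤ := fun N' _ _ _ _ =>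
      (Submodule.top_ne_ideal_smul_of_le_jacobson_annihilator
        (maximalIdeal_le_jacobson _)).symm.lt_top
    have hnt : Nontrivial (QuotSMulTop x N) := nontrivial_quotSMulTop_of_mem_maximalIdeal _ hxm
    -- Depth at least `n` means that `Ext^i` from the residue field vanishes for `i < n`; the long
    -- exact sequence of multiplication by `x` costs one degree.
    let E : ModuleCat.{u} R := ModuleCat.of R (R ⧸ maximalIdeal R)
    have hE : Module.support R E = PrimeSpectrum.zeroLocus (maximalIdeal R) := by
      change Module.support R (R ⧸ maximalIdeal R) = _
      rw [Module.support_eq_zeroLocus, Ideal.annihilator_quotient]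
    have hfin : Module.Finite R E := inferInstanceAs (Module.Finite R (R ⧸ maximalIdeal R))
    have hN := ModuleCat.subsingleton_ext_of_exists_isRegular (maximalIdeal R) E hE.subset
      (ModuleCat.of R N) (nak N) rs hm
      ((isRegular_iff_isWeaklyRegular_of_subset_maximalIdeal hm).2 hrs)
    obtain ⟨ss, h1, h2, h3⟩ := ModuleCat.exists_isRegular_of_exists_subsingleton_ext
      (maximalIdeal R) (rs.length - 1) (ModuleCat.of R (QuotSMulTop x N)) (nak _) E hE (by
        intro i hi
        have zero1 := AddCommGrpCat.isZero_of_iff_subsingleton.mpr (hN i (by omega))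
        have zero2 := AddCommGrpCat.isZero_of_iff_subsingleton.mpr (hN (i + 1) (by omega))
        have hx' : IsSMulRegular (ModuleCat.of R N) x := hx
        exact AddCommGrpCat.subsingleton_of_isZero <| ShortComplex.Exact.isZero_of_both_zeros
          ((Ext.covariant_sequence_exact₃' E hx'.smulShortComplex_shortExact) i (i + 1) rfl)
          (zero1.eq_zero_of_src _) (zero2.eq_zero_of_tgt _))
    exact ⟨ss, h1, h2, h3.1⟩

/-- Over a Noetherian local ring, if a finite module has depth at least `n`, then every sequence of
`n` elements of the maximal ideal that cuts its support down to the closed point is regular. -/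
theorem IsLocalRing.isWeaklyRegular_of_support_subset (Θ : List R)
    (hΘ : ∀ θ ∈ Θ, θ ∈ maximalIdeal R) (N : Type u) [AddCommGroup N] [Module R N]
    [Module.Finite R N] (rs : List R) (hlen : rs.length = Θ.length)
    (hm : ∀ r ∈ rs, r ∈ maximalIdeal R) (hrs : IsWeaklyRegular N rs)
    (hsupp : Module.support R N ∩ zeroLocus (Ideal.ofList Θ : Set R) ⊆ {closedPoint R}) :
    IsWeaklyRegular N Θ := by
  induction Θ generalizing N rs with
  | nil => exact IsWeaklyRegular.nil R N
  | cons θ Θ ih =>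
    have hθ : θ ∈ maximalIdeal R := hΘ θ (by simp)
    have hΘ' : ∀ r ∈ Θ, r ∈ maximalIdeal R := fun r hr => hΘ r (by simp [hr])
    have hreg : IsSMulRegular N θ := by
      by_contra hcon
      have hz : ∃ x : N, x ≠ 0 ∧ θ • x = 0 := by
        by_contra hne
        push Not at hne
        refine hcon fun x y hxy => ?_
        by_contra hxy'
        exact hne (x - y) (sub_ne_zero.2 hxy') (by
          simp only at hxy
          rw [smul_sub, hxy, sub_self])
      -- If the kernel `L` of `θ` were nonzero, its dimension would be at least `Θ.length + 1` by
      -- depth. But `θ` kills `L`, so the remaining `Θ` already cut its support down to the closed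
      -- point, and its dimension is at most `Θ.length`.
      let L : Submodule R N := LinearMap.ker (LinearMap.lsmul R N θ)
      have hL : L ≠ ⊥ := by
        obtain ⟨x, hx, hx'⟩ := hz
        exact fun h => hx ((Submodule.mem_bot R).1 (h ▸ (show x ∈ L from hx')))
      have h1 := length_le_supportDim_of_isWeaklyRegular rs hm N hrs L hL
      have h2 := supportDim_le_supportDim_quotient_ofList_add_length Θ hΘ' L
      have h3 : supportDim R (L ⧸ (Ideal.ofList Θ • ⊤ : Submodule R L)) ≤ 0 := by
        have hsub : Module.support R (L ⧸ (Ideal.ofList Θ • ⊤ : Submodule R L)) ⊆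
            {closedPoint R} := by
          intro p hp
          rw [Module.support_quotient] at hp
          refine hsupp ⟨Module.support_subset_of_injective L.subtype L.injective_subtype hp.1, ?_⟩
          rw [mem_zeroLocus, Ideal.ofList_cons, SetLike.coe_subset_coe, sup_le_iff,
            Ideal.span_singleton_le_iff_mem]
          refine ⟨Module.mem_support_iff_of_finite.1 hp.1 ?_, hp.2⟩
          rw [Module.mem_annihilator]
          exact fun x => Subtype.ext x.2
        have : Subsingleton (Module.support R (L ⧸ (Ideal.ofList Θ • ⊤ : Submodule R L))) :=
          (Set.subsingleton_singleton.anti hsub).coe_sort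
        exact Order.krullDim_nonpos_of_subsingleton
      have h4 : ((Θ.length + 1 : ℕ) : WithBot ℕ∞) ≤ Θ.length := by
        calc ((Θ.length + 1 : ℕ) : WithBot ℕ∞) = rs.length := by rw [hlen]; simp
          _ ≤ _ := h1
          _ ≤ _ := h2
          _ ≤ 0 + Θ.length := by gcongr
          _ = _ := by simp
      have h5 : Θ.length + 1 ≤ Θ.length := by exact_mod_cast h4
      omega
    -- The tail of `rs` need not be regular on `N / θN`; a fresh regular sequence of the right
    -- length replaces it.
    obtain ⟨ss, hs1, hs2, hs3⟩ := exists_isWeaklyRegular_quotSMulTop rs hm N hrs hθ hreg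
    rw [isWeaklyRegular_cons_iff]
    refine ⟨hreg, ih hΘ' (QuotSMulTop θ N) ss (by rw [hs1, hlen]; simp) hs2 hs3 ?_⟩
    intro p hp
    rw [Module.support_quotSMulTop] at hp
    refine hsupp ⟨hp.1.1, ?_⟩
    rw [mem_zeroLocus, Ideal.ofList_cons, SetLike.coe_subset_coe, sup_le_iff,
      Ideal.span_singleton_le_iff_mem]
    exact ⟨by simpa using hp.1.2, hp.2⟩

end LocalDepth

open MvPolynomial

noncomputable section

namespace StanleyReisner

/-! ### Nonface ideals and the quotients of the relative face module. -/

section FaceIdeals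

open RingTheory.Sequence

attribute [local instance] MvPolynomial.gradedAlgebra

variable {V : Type*} {k : Type*} [Field k]

theorem prod_X_eq_monomial (σ : Finset V) :
    (∏ v ∈ σ, X v : MvPolynomial V k) = monomial (∑ v ∈ σ, Finsupp.single v 1) 1 := by
  rw [monomial_sum_one]
  rfl

theorem sum_single_le_iff (σ : Finset V) (a : V →₀ ℕ) :
    (∑ v ∈ σ, Finsupp.single v 1) ≤ a ↔ σ ⊆ a.support := by
  classical
  have h : ∀ w, (∑ v ∈ σ, Finsupp.single v 1 : V →₀ ℕ) w = if w ∈ σ then 1 else 0 := by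
    intro w
    simp [Finsupp.finsetSum_apply, Finsupp.single_apply]
  constructor
  · intro hle w hw
    have := hle w
    rw [h, if_pos hw] at this
    exact Finsupp.mem_support_iff.2 (by omega)
  · intro hsub w
    rw [h]
    split_ifs with hw
    · exact Nat.one_le_iff_ne_zero.2 (Finsupp.mem_support_iff.1 (hsub hw))
    · exact Nat.zero_le _

/-- The ideal is monomial, and the generator of `σ` divides a monomial exactly when `σ` lies in its
support. Membership thus becomes a condition on the supports of single monomials. -/
theorem mem_nonfaceIdeal {Δ : Complex V} {f : MvPolynomial V k} :
    f ∈ nonfaceIdeal k Δ ↔ ∀ a ∈ f.support, a.support ∉ Δ := by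
  have : {f : MvPolynomial V k | ∃ σ : Finset V, σ ∉ Δ ∧ f = ∏ v ∈ σ, X v} =
      (fun s => monomial s (1 : k)) '' {a | ∃ σ : Finset V, σ ∉ Δ ∧
        a = ∑ v ∈ σ, Finsupp.single v 1} := by
    ext f
    constructor
    · rintro ⟨σ, h, rfl⟩
      exact ⟨_, ⟨σ, h, rfl⟩, (prod_X_eq_monomial σ).symm⟩
    · rintro ⟨_, ⟨σ, h, rfl⟩, rfl⟩
      exact ⟨σ, h, (prod_X_eq_monomial σ).symm⟩
  rw [nonfaceIdeal, this, mem_ideal_span_monomial_image]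
  refine forall₂_congr fun a _ => ?_
  constructor
  · rintro ⟨_, ⟨σ, h, rfl⟩, hle⟩ ha
    exact h (Δ.lower ((sum_single_le_iff σ a).1 hle) ha)
  · exact fun ha => ⟨_, ⟨a.support, ha, rfl⟩, (sum_single_le_iff _ a).2 subset_rfl⟩

theorem nonfaceIdeal_anti {Γ Δ : Complex V} (h : Γ ≤ Δ) : nonfaceIdeal k Δ ≤ nonfaceIdeal k Γ :=
  fun _ hf => mem_nonfaceIdeal.2 fun a ha hΓ => mem_nonfaceIdeal.1 hf a ha (h hΓ)

theorem nonfaceIdeal_isHomogeneous (Δ : Complex V) :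
    (nonfaceIdeal k Δ).IsHomogeneous (homogeneousSubmodule V k) := by
  refine Ideal.homogeneous_span _ _ ?_
  rintro _ ⟨σ, -, rfl⟩
  exact ⟨_, IsHomogeneous.prod σ _ (fun _ => 1) fun v _ => isHomogeneous_X k v⟩

variable (k) in
/-- The ideal `I_Δ + ⟨Θ⟩ I_Γ`; dividing `I_Γ` by it gives `k[Ψ] / ⟨Θ⟩ k[Ψ]`. -/
def relIdeal (Ψ : RelComplex V) (Θ : List (MvPolynomial V k)) : Ideal (MvPolynomial V k) :=
  nonfaceIdeal k Ψ.Δ ⊔ Ideal.ofList Θ * nonfaceIdeal k Ψ.Γ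

theorem relIdeal_le (Ψ : RelComplex V) (Θ : List (MvPolynomial V k)) :
    relIdeal k Ψ Θ ≤ nonfaceIdeal k Ψ.Γ :=
  sup_le (nonfaceIdeal_anti Ψ.le) Ideal.mul_le_right

theorem relIdeal_nil (Ψ : RelComplex V) : relIdeal k Ψ [] = nonfaceIdeal k Ψ.Δ := by
  simp [relIdeal]

theorem relIdeal_concat (Ψ : RelComplex V) (Θ : List (MvPolynomial V k)) (θ : MvPolynomial V k) :
    relIdeal k Ψ (Θ ++ [θ]) = relIdeal k Ψ Θ ⊔ Ideal.span {θ} * nonfaceIdeal k Ψ.Γ := by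
  simp [relIdeal, Ideal.ofList_append, Ideal.sup_mul, sup_assoc]

theorem relIdeal_isHomogeneous (Ψ : RelComplex V) (Θ : List (MvPolynomial V k))
    (hΘ : ∀ θ ∈ Θ, ∃ e, θ.IsHomogeneous e) :
    (relIdeal k Ψ Θ).IsHomogeneous (homogeneousSubmodule V k) :=
  (nonfaceIdeal_isHomogeneous _).sup
    ((Ideal.homogeneous_span _ _ hΘ).mul (nonfaceIdeal_isHomogeneous _))

/-- The preimage of `⟨Θ⟩ k[Ψ]` in `I_Γ` is `I_Δ + ⟨Θ⟩ I_Γ`. This lets the rest of the proof work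
with ideals of one polynomial ring in place of iterated quotients. -/
theorem mkQ_mem_ofList_smul_top (Ψ : RelComplex V) (Θ : List (MvPolynomial V k))
    (f : nonfaceIdeal k Ψ.Γ) :
    ((nonfaceIdeal k Ψ.Δ).submoduleOf (nonfaceIdeal k Ψ.Γ)).mkQ f ∈
      (Ideal.ofList Θ • ⊤ : Submodule (MvPolynomial V k) (FaceModule k Ψ)) ↔
    (f : MvPolynomial V k) ∈ relIdeal k Ψ Θ := by
  rw [← Submodule.mem_comap, Submodule.comap_smul_top_of_surjective _ _
    (Submodule.mkQ_surjective _), Submodule.ker_mkQ]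
  have key : (Ideal.ofList Θ • ⊤ ⊔ (nonfaceIdeal k Ψ.Δ).submoduleOf (nonfaceIdeal k Ψ.Γ) :
      Submodule (MvPolynomial V k) (nonfaceIdeal k Ψ.Γ)) =
      (relIdeal k Ψ Θ).submoduleOf (nonfaceIdeal k Ψ.Γ) := by
    apply Submodule.map_injective_of_injective (nonfaceIdeal k Ψ.Γ).injective_subtype
    rw [Submodule.map_sup, Submodule.map_smul'', Submodule.map_top, Submodule.range_subtype,
      Submodule.submoduleOf, Submodule.submoduleOf, Submodule.map_comap_subtype,
      Submodule.map_comap_subtype, inf_eq_right.2 (nonfaceIdeal_anti Ψ.le),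
      inf_eq_right.2 (relIdeal_le Ψ Θ), relIdeal, sup_comm]
    rfl
  rw [key]
  rfl

end FaceIdeals

/-! ### From local regularity back to homogeneous elements. -/

section Regularity

open RingTheory.Sequence IsLocalRing

attribute [local instance] MvPolynomial.gradedAlgebra

/-- Such a `q` lies in the support of `M / IM`, so it contains the annihilator. Modulo that
annihilator, `A` embeds in the endomorphisms of a finite dimensional space, so `A / q` is a finite
dimensional domain, hence a field. -/
theorem isMaximal_of_finite_quotient {k A M : Type*} [Field k] [CommRing A] [Algebra k A]
    [AddCommGroup M] [Module k M] [Module A M] [IsScalarTower k A M] [Module.Finite A M]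
    (I : Ideal A) (hfin : Module.Finite k (M ⧸ (I • ⊤ : Submodule A M))) (q : Ideal A) [q.IsPrime]
    (hann : Module.annihilator A M ≤ q) (hI : I ≤ q) : q.IsMaximal := by
  let Q := M ⧸ (I • ⊤ : Submodule A M)
  have hq : Module.annihilator A Q ≤ q := by
    have : (⟨q, ‹_›⟩ : PrimeSpectrum A) ∈ Module.support A Q := by
      rw [Module.support_quotient]
      exact ⟨Module.mem_support_iff_of_finite.2 hann, hI⟩
    exact Module.mem_support_iff_of_finite.1 this
  let φ : A →ₗ[k] Module.End k Q := (Algebra.lsmul k k Q).toLinearMap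
  have hker : LinearMap.ker φ ≤ q.restrictScalars k := by
    intro a ha
    refine hq (Module.mem_annihilator.2 fun x => ?_)
    exact LinearMap.congr_fun (LinearMap.mem_ker.1 ha) x
  have h1 : Module.Finite k (A ⧸ LinearMap.ker φ) :=
    Module.Finite.of_injective (φ.quotKerEquivRange.toLinearMap) φ.quotKerEquivRange.injective
  have h2 : Module.Finite k (A ⧸ q) := by
    refine Module.Finite.of_surjective (M := A ⧸ LinearMap.ker φ)
      ((LinearMap.ker φ).liftQ (Ideal.Quotient.mkₐ k q).toLinearMap fun a ha => ?_) ?_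
    · exact Ideal.Quotient.eq_zero_iff_mem.2 (hker ha)
    · intro x
      obtain ⟨a, rfl⟩ := Ideal.Quotient.mk_surjective x
      exact ⟨Submodule.Quotient.mk a, rfl⟩
  exact Ideal.Quotient.maximal_of_isField q
    (isField_of_isIntegral_of_isField' (R := k) (Field.toIsField k))

variable {V : Type*} {k : Type*} [Field k]

variable (V k) in
/-- The irrelevant maximal ideal of the polynomial ring. -/
def irrelevantIdeal : Ideal (MvPolynomial V k) :=
  RingHom.ker (constantCoeff : MvPolynomial V k →+* k)

instance : (irrelevantIdeal V k).IsMaximal :=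
  RingHom.ker_isMaximal_of_surjective _ fun a => ⟨C a, constantCoeff_C V a⟩

theorem mem_irrelevantIdeal_of_isHomogeneous {f : MvPolynomial V k} {e : ℕ} (he : 0 < e)
    (hf : f.IsHomogeneous e) : f ∈ irrelevantIdeal V k := by
  change coeff 0 f = 0
  by_contra h
  have := hf h
  simp at this
  omega

/-- A homogeneous element is in a homogeneous ideal if its image in the localization at the
irrelevant ideal is. -/
theorem mem_of_mul_mem_of_isHomogeneous {J : Ideal (MvPolynomial V k)}
    (hJ : J.IsHomogeneous (homogeneousSubmodule V k)) {f s : MvPolynomial V k} {d : ℕ}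
    (hf : f.IsHomogeneous d) (hs : s ∉ irrelevantIdeal V k) (hsf : s * f ∈ J) : f ∈ J := by
  -- The degree `d` component of `s * f` is the constant term of `s` times `f`, and that constant is
  -- a unit.
  have h1 : homogeneousComponent d (s * f) ∈ J := homogeneousComponent_mem_of_mem hJ hsf d
  have h2 : homogeneousComponent d (s * f) = homogeneousComponent 0 s * f := by
    have := DirectSum.coe_decompose_mul_of_right_mem_of_le (homogeneousSubmodule V k) (a := s)
      (b := f) (n := d) (i := d) hf le_rfl
    rw [Nat.sub_self] at this
    have e1 := decomposition.decompose'_apply (R := k) (σ := V) (s * f) d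
    have e2 := decomposition.decompose'_apply (R := k) (σ := V) s 0
    rw [← e1, ← e2]
    exact this
  rw [h2, homogeneousComponent_zero] at h1
  have hc : coeff 0 s ≠ 0 := hs
  have := J.mul_mem_left (C (coeff 0 s)⁻¹) h1
  rwa [← mul_assoc, ← C_mul, inv_mul_cancel₀ hc, C_1, one_mul] at this

/-- On a Cohen-Macaulay face module each homogeneous system of parameters is a regular sequence,
as far as homogeneous elements are concerned. -/
theorem IsHSOP.mem_relIdeal_of_mul_mem [Finite V] {Ψ : RelComplex V} {Θ : List (MvPolynomial V k)}
    (hΘ : IsHSOP k (FaceModule k Ψ) Θ) (hCM : IsCohenMacaulay (V := V) k (FaceModule k Ψ))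
    (i : ℕ) (hi : i < Θ.length) {f : MvPolynomial V k} {d : ℕ} (hf : f ∈ nonfaceIdeal k Ψ.Γ)
    (hfd : f.IsHomogeneous d) (hmul : Θ[i] * f ∈ relIdeal k Ψ (Θ.take i)) :
    f ∈ relIdeal k Ψ (Θ.take i) := by
  obtain hsub | ⟨Φ, hΦ, hreg⟩ := hCM
  · refine (mkQ_mem_ofList_smul_top Ψ _ ⟨f, hf⟩).1 ?_
    rw [Subsingleton.elim (Submodule.mkQ _ _) 0]
    exact zero_mem _
  -- Both sequences have minimal length, so the regular one is long enough for the depth criterion.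
  have hlen : Φ.length = Θ.length := le_antisymm (hΦ.minimal Θ hΘ.homogeneous hΘ.finite)
    (hΘ.minimal Φ hΦ.homogeneous hΦ.finite)
  let A := MvPolynomial V k
  let m := irrelevantIdeal V k
  let M := FaceModule k Ψ
  let S := Localization.AtPrime m
  let N := LocalizedModule m.primeCompl M
  let ℓ : M →ₗ[A] N := LocalizedModule.mkLinearMap m.primeCompl M
  have hmap : ∀ L : List A, (∀ φ ∈ L, ∃ e, 0 < e ∧ φ.IsHomogeneous e) →
      ∀ r ∈ L.map (algebraMap A S), r ∈ maximalIdeal S := by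
    intro L hL r hr
    obtain ⟨φ, hφ, rfl⟩ := List.mem_map.1 hr
    obtain ⟨e, he, hφe⟩ := hL φ hφ
    exact (IsLocalization.AtPrime.to_map_mem_maximal_iff S m φ).2
      (mem_irrelevantIdeal_of_isHomogeneous he hφe)
  have hNfin : Module.Finite S N := Module.Finite.of_isLocalizedModule m.primeCompl ℓ
  have hN : IsWeaklyRegular N (Θ.map (algebraMap A S)) := by
    refine isWeaklyRegular_of_support_subset _ (hmap Θ hΘ.homogeneous) N (Φ.map (algebraMap A S))
      (by simp [hlen]) (hmap Φ hΦ.homogeneous)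
      (hreg.1.of_isLocalizedModule S m.primeCompl ℓ) ?_
    rintro p ⟨hp1, hp2⟩
    let q := p.asIdeal.comap (algebraMap A S)
    have hq1 : Module.annihilator A M ≤ q := by
      intro a ha
      refine Module.mem_support_iff_of_finite.1 hp1 (Module.mem_annihilator.2 fun x => ?_)
      obtain ⟨⟨y, s⟩, rfl⟩ := IsLocalizedModule.mk'_surjective m.primeCompl ℓ x
      rw [algebraMap_smul, Function.uncurry_apply_pair, ← IsLocalizedModule.mk'_smul,
        Module.mem_annihilator.1 ha, IsLocalizedModule.mk'_zero]
    have hq2 : Ideal.ofList Θ ≤ q := by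
      rw [← Ideal.map_le_iff_le_comap, Ideal.map_ofList]
      exact hp2
    -- A prime of the localization that meets the support and contains `Θ` contracts to a maximal
    -- ideal inside `m`, hence to `m`: this is the support condition of the local criterion.
    have hqmax : q.IsMaximal := isMaximal_of_finite_quotient (k := k) (M := M) _ hΘ.finite q hq1 hq2
    have hqm : q = m := hqmax.eq_of_le (Ideal.IsPrime.ne_top inferInstance) (by
      have : p.asIdeal ≤ maximalIdeal S := le_maximalIdeal p.2.ne_top
      exact (Ideal.comap_mono this).trans
        (le_of_eq (IsLocalization.AtPrime.under_maximalIdeal S m)))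
    rw [Set.mem_singleton_iff]
    refine PrimeSpectrum.ext (le_antisymm (le_maximalIdeal p.2.ne_top) ?_)
    change maximalIdeal S ≤ p.asIdeal
    rw [← Localization.AtPrime.map_eq_maximalIdeal, Ideal.map_le_iff_le_comap]
    exact hqm.ge
  rw [isWeaklyRegular_iff] at hN
  have hreg_i := hN i (by simpa using hi)
  rw [← List.map_take, ← Ideal.map_ofList] at hreg_i
  let x : M := Submodule.mkQ _ (⟨f, hf⟩ : nonfaceIdeal k Ψ.Γ)
  have hloc : (Ideal.map (algebraMap A S) (Ideal.ofList (Θ.take i)) • ⊤ : Submodule S N) =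
      Submodule.localized' S m.primeCompl ℓ (Ideal.ofList (Θ.take i) • ⊤ : Submodule A M) := by
    rw [Submodule.localized'_smul, Ideal.localized'_eq_map, Submodule.localized'_top]
  have hx : Θ[i] • x ∈ (Ideal.ofList (Θ.take i) • ⊤ : Submodule A M) := by
    have := (mkQ_mem_ofList_smul_top Ψ (Θ.take i)
      ⟨Θ[i] * f, Ideal.mul_mem_left _ _ hf⟩).2 hmul
    exact this
  have hx' : ℓ x ∈ (Ideal.map (algebraMap A S) (Ideal.ofList (Θ.take i)) • ⊤ : Submodule S N) := by
    rw [← Submodule.Quotient.mk_eq_zero]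
    refine hreg_i ?_
    simp only [smul_zero]
    rw [← Submodule.Quotient.mk_smul, Submodule.Quotient.mk_eq_zero, hloc, List.getElem_map,
      algebraMap_smul, ← map_smul]
    exact ⟨_, hx, 1, IsLocalizedModule.mk'_one _ _ _⟩
  rw [hloc] at hx'
  -- Clearing denominators leaves a multiplier outside the irrelevant ideal, which can be cancelled
  -- because `f` is homogeneous.
  obtain ⟨y, hy, s, hys⟩ := hx'
  obtain ⟨c, hc⟩ := (IsLocalizedModule.mk'_eq_iff.1 hys |> fun h => by
    rw [Submonoid.smul_def, ← map_smul] at h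
    exact (IsLocalizedModule.eq_iff_exists m.primeCompl ℓ).1 h :
      ∃ c : m.primeCompl, c • y = c • ((s : A) • x))
  have hcs : ((c * s : m.primeCompl) : A) • x ∈
      (Ideal.ofList (Θ.take i) • ⊤ : Submodule A M) := by
    rw [Submonoid.coe_mul, mul_smul]
    change c • ((s : A) • x) ∈ _
    rw [← hc]
    exact Submodule.smul_mem _ _ hy
  have hcs' := (mkQ_mem_ofList_smul_top Ψ (Θ.take i)
      ⟨((c * s : m.primeCompl) : A) * f, Ideal.mul_mem_left _ _ hf⟩).1 hcs
  refine mem_of_mul_mem_of_isHomogeneous (relIdeal_isHomogeneous Ψ _ fun θ hθ => ?_) hfd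
    (c * s).2 hcs'
  obtain ⟨e, -, he⟩ := hΘ.homogeneous θ (List.mem_of_mem_take hθ)
  exact ⟨e, he⟩

end Regularity

/-! ### Generic linear forms are systems of parameters. -/

section Parameters

variable {V : Type*} {k : Type*} [Field k]

variable (k) in
/-- The prime ideal generated by the variables outside `σ`. -/
def facePrime (σ : Finset V) : Ideal (MvPolynomial V k) :=
  Ideal.span (X '' {v | v ∉ σ})

theorem mem_facePrime {σ : Finset V} {f : MvPolynomial V k} :
    f ∈ facePrime k σ ↔ ∀ a ∈ f.support, ¬ a.support ⊆ σ := by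
  rw [facePrime, mem_ideal_span_X_image]
  refine forall₂_congr fun a _ => ?_
  simp only [Finset.not_subset, Finsupp.mem_support_iff, Set.mem_ofPred_eq]
  exact ⟨fun ⟨v, h1, h2⟩ => ⟨v, h2, h1⟩, fun ⟨v, h1, h2⟩ => ⟨v, h2, h1⟩⟩

theorem RelComplex.exists_facet [Finite V] (Ψ : RelComplex V) {σ : Finset V} (hσ : σ ∈ Ψ.faces) :
    ∃ ρ, Maximal (· ∈ Ψ.faces) ρ ∧ σ ⊆ ρ := by
  obtain ⟨ρ, h1, h2⟩ := (Set.toFinite Ψ.faces).exists_le_maximal hσ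
  exact ⟨ρ, h2, h1⟩

/-- Modulo `⟨Θ⟩ M` each element of the subalgebra generated by `Θ` acts as a scalar, so generators
over the subalgebra span over `k`. -/
theorem finite_quotient_ofList_smul_top {k A M : Type*} [Field k] [CommRing A] [Algebra k A]
    [AddCommGroup M] [Module k M] [Module A M] [IsScalarTower k A M] (Θ : List A)
    (hM : Module.Finite (Algebra.adjoin k {θ | θ ∈ Θ}) M) :
    Module.Finite k (M ⧸ (Ideal.ofList Θ • ⊤ : Submodule A M)) := by
  let S : Subalgebra k A := Algebra.adjoin k {θ | θ ∈ Θ}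
  let Q := M ⧸ (Ideal.ofList Θ • ⊤ : Submodule A M)
  let π : M →ₗ[A] Q := Submodule.mkQ _
  have hπ : Function.Surjective π := Submodule.mkQ_surjective _
  have hQ : Module.Finite S Q := Module.Finite.of_surjective (π.restrictScalars S) hπ
  have hsc : ∀ s ∈ S, ∃ c : k, ∀ x : Q, s • x = c • x := by
    intro s hs
    induction hs using Algebra.adjoin_induction with
    | mem θ hθ =>
      refine ⟨0, fun x => ?_⟩
      obtain ⟨x, rfl⟩ := Submodule.Quotient.mk_surjective _ x
      rw [zero_smul, ← Submodule.Quotient.mk_smul, Submodule.Quotient.mk_eq_zero]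
      exact Submodule.smul_mem_smul (Ideal.subset_span hθ) trivial
    | algebraMap c => exact ⟨c, fun x => algebraMap_smul A c x⟩
    | add s t _ _ hs ht =>
      obtain ⟨c, hc⟩ := hs
      obtain ⟨d, hd⟩ := ht
      exact ⟨c + d, fun x => by rw [add_smul, add_smul, hc, hd]⟩
    | mul s t _ _ hs ht =>
      obtain ⟨c, hc⟩ := hs
      obtain ⟨d, hd⟩ := ht
      exact ⟨c * d, fun x => by rw [mul_smul, mul_smul, hd, hc]⟩
  obtain ⟨T, hT⟩ := hQ.fg_top
  refine ⟨⟨T, ?_⟩⟩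
  rw [eq_top_iff]
  intro x _
  have hx : x ∈ Submodule.span S (T : Set Q) := hT ▸ trivial
  induction hx using Submodule.span_induction with
  | mem x hx => exact Submodule.subset_span hx
  | zero => exact zero_mem _
  | add x y _ _ hx hy => exact add_mem (hx trivial) (hy trivial)
  | smul s x _ hx =>
    obtain ⟨c, hc⟩ := hsc s.1 s.2
    have : s • x = c • x := hc x
    rw [this]
    exact Submodule.smul_mem _ c (hx trivial)

/-- If the coordinate rings of all facets are finite over the subalgebra generated by `Θ`, then
`k[Ψ] / ⟨Θ⟩ k[Ψ]` is finite dimensional. -/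
theorem finite_quotientBy_of_forall_facet [Finite V] (Ψ : RelComplex V)
    (Θ : List (MvPolynomial V k))
    (h : ∀ σ, Maximal (· ∈ Ψ.faces) σ → ∀ v, ∃ s ∈ Algebra.adjoin k {θ | θ ∈ Θ},
      (X v : MvPolynomial V k) - s ∈ facePrime k σ) :
    Module.Finite k (QuotientBy (FaceModule k Ψ) Θ) := by
  let A := MvPolynomial V k
  let S : Subalgebra k A := Algebra.adjoin k {θ | θ ∈ Θ}
  let F := {σ // Maximal (· ∈ Ψ.faces) σ}
  have hfg : S.FG := Subalgebra.fg_def.2 ⟨_, List.finite_toSet Θ, rfl⟩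
  have : Algebra.FiniteType k S := S.fg_iff_finiteType.1 hfg
  have : IsNoetherianRing S := Algebra.FiniteType.isNoetherianRing k S
  have hfin : ∀ σ : F, Module.Finite S (A ⧸ facePrime k σ.1) := by
    intro σ
    refine Module.Finite.of_surjective (Algebra.linearMap S (A ⧸ facePrime k σ.1)) ?_
    have htop : S.map (Ideal.Quotient.mkₐ k (facePrime k σ.1)) = ⊤ := by
      rw [← (AlgHom.range_eq_top _).2 (Ideal.Quotient.mkₐ_surjective k (facePrime k σ.1)),
        ← Algebra.map_top]
      refine le_antisymm (Subalgebra.map_mono le_top) ?_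
      rw [← MvPolynomial.adjoin_range_X, AlgHom.map_adjoin, Algebra.adjoin_le_iff]
      rintro _ ⟨_, ⟨v, rfl⟩, rfl⟩
      obtain ⟨s, hs, hvs⟩ := h σ.1 σ.2 v
      exact ⟨s, hs, ((Ideal.Quotient.mk_eq_mk_iff_sub_mem _ _).2 hvs).symm⟩
    intro x
    have : x ∈ S.map (Ideal.Quotient.mkₐ k (facePrime k σ.1)) := htop ▸ Algebra.mem_top
    obtain ⟨s, hs, rfl⟩ := this
    exact ⟨⟨s, hs⟩, rfl⟩
  -- `k[Ψ]` embeds in the product of the coordinate rings of the facets: a monomial of `I_Γ` whose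
  -- support lies in `Δ` is supported on a facet. Each factor is a quotient of the Noetherian ring
  -- `S`, so submodules of the product are finite over `S`.
  let g : nonfaceIdeal k Ψ.Γ →ₗ[A] (∀ σ : F, A ⧸ facePrime k σ.1) :=
    LinearMap.pi fun σ => (Submodule.mkQ (facePrime k σ.1)).comp (Submodule.subtype _)
  have hg : LinearMap.ker g = (nonfaceIdeal k Ψ.Δ).submoduleOf (nonfaceIdeal k Ψ.Γ) := by
    ext f
    change g f = 0 ↔ (f : A) ∈ nonfaceIdeal k Ψ.Δ
    have h1 : g f = 0 ↔ ∀ σ : F, (f : A) ∈ facePrime k σ.1 := by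
      rw [funext_iff]
      exact forall_congr' fun σ => Submodule.Quotient.mk_eq_zero _
    rw [h1]
    constructor
    · refine fun hf => mem_nonfaceIdeal.2 fun a ha haΔ => ?_
      obtain ⟨ρ, hρ, hle⟩ := Ψ.exists_facet (σ := a.support)
        ⟨haΔ, mem_nonfaceIdeal.1 f.2 a ha⟩
      exact mem_facePrime.1 (hf ⟨ρ, hρ⟩) a ha hle
    · exact fun hf σ => mem_facePrime.2 fun a ha hle =>
        mem_nonfaceIdeal.1 hf a ha (Ψ.Δ.lower hle σ.2.1.1)
  let g' : FaceModule k Ψ →ₗ[A] (∀ σ : F, A ⧸ facePrime k σ.1) :=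
    Submodule.liftQ _ g hg.ge
  have hg' : Function.Injective g' := by
    rw [← LinearMap.ker_eq_bot]
    exact Submodule.ker_liftQ_eq_bot _ _ _ hg.le
  have hM : Module.Finite S (FaceModule k Ψ) :=
    Module.Finite.of_injective (g'.restrictScalars S) hg'
  exact finite_quotient_ofList_smul_top Θ hM

open Classical in
variable (k) in
/-- The substitution that sends the variables in `s` to zero. -/
def killVars (s : Finset V) : MvPolynomial V k →ₐ[k] MvPolynomial V k :=
  aeval fun v => if v ∈ s then 0 else X v

open Classical in
theorem killVars_X (s : Finset V) (v : V) :
    killVars k s (X v) = if v ∈ s then 0 else X v := aeval_X _ v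

theorem killVars_comp_of_subset {s t : Finset V} (h : s ⊆ t) :
    (killVars k t).comp (killVars k s) = killVars k t := by
  classical
  refine MvPolynomial.algHom_ext fun w => ?_
  rw [AlgHom.comp_apply, killVars_X, killVars_X]
  by_cases hw : w ∈ s
  · rw [if_pos hw, if_pos (h hw), map_zero]
  · rw [if_neg hw, killVars_X]

/-- Killing the variables one at a time gives a strictly increasing chain of kernels, which are
prime because the target is a domain. -/
theorem card_le_height_ker_killVars (s : Finset V) :
    (s.card : ℕ∞) ≤ (RingHom.ker (killVars k s)).height := by
  classical
  have hq : ∀ s : Finset V, (RingHom.ker (killVars k s)).IsPrime := fun s => RingHom.ker_isPrime _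
  induction s using Finset.induction_on with
  | empty => simp
  | insert v s hv ih =>
    have hlt : RingHom.ker (killVars k s) < RingHom.ker (killVars k (insert v s)) := by
      refine lt_of_le_of_ne (fun f hf => ?_) fun h => ?_
      · rw [RingHom.mem_ker] at hf ⊢
        rw [← killVars_comp_of_subset (Finset.subset_insert v s), AlgHom.comp_apply, hf, map_zero]
      · have h1 : (X v : MvPolynomial V k) ∈ RingHom.ker (killVars k (insert v s)) := by
          rw [RingHom.mem_ker, killVars_X, if_pos (Finset.mem_insert_self v s)]
        rw [← h, RingHom.mem_ker, killVars_X, if_neg hv] at h1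
        exact X_ne_zero v h1
    rw [Finset.card_insert_of_notMem hv, Nat.cast_add, Nat.cast_one]
    exact (add_le_add_left ih 1).trans (Ideal.height_add_one_le_of_lt_of_isPrime hlt)

theorem card_le_height_irrelevantIdeal [Fintype V] :
    (Fintype.card V : ℕ∞) ≤ (irrelevantIdeal V k).height := by
  classical
  refine (card_le_height_ker_killVars (k := k) Finset.univ).trans
    (Ideal.height_mono fun f hf => ?_)
  rw [RingHom.mem_ker] at hf
  have h : (constantCoeff : MvPolynomial V k →+* k).comp
      (killVars k (Finset.univ : Finset V)).toRingHom = constantCoeff := by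
    refine MvPolynomial.ringHom_ext (fun r => ?_) fun v => ?_
    · simp
    · simp [killVars_X]
  change constantCoeff f = 0
  rw [← h]
  simp [hf]

/-- A facet with `n` elements forces each system of parameters to have at least `n` elements. -/
theorem card_le_length_of_finite_quotientBy [Fintype V] (Ψ : RelComplex V) {σ : Finset V}
    (hσ : Maximal (· ∈ Ψ.faces) σ) (Φ : List (MvPolynomial V k))
    (hΦ : ∀ φ ∈ Φ, ∃ e, 0 < e ∧ φ.IsHomogeneous e)
    (hfin : Module.Finite k (QuotientBy (FaceModule k Ψ) Φ)) : σ.card ≤ Φ.length := by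
  classical
  -- Test the annihilator on the monomial of `σ`: multiplying it by a monomial in the variables of
  -- `σ` keeps the support equal to `σ`, a face, so the product is nonzero in `k[Ψ]`.
  have hann : Module.annihilator (MvPolynomial V k) (FaceModule k Ψ) ≤ facePrime k σ := by
    intro a ha
    let xσ : MvPolynomial V k := monomial (∑ v ∈ σ, Finsupp.single v 1) 1
    have hsupp : (∑ v ∈ σ, Finsupp.single v 1 : V →₀ ℕ).support = σ := by
      ext w
      simp [Finsupp.finsetSum_apply, Finsupp.single_apply]
    have hx : xσ ∈ nonfaceIdeal k Ψ.Γ := mem_nonfaceIdeal.2 fun b hb => by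
      rw [show b = ∑ v ∈ σ, Finsupp.single v 1 from
        Finset.mem_singleton.1 (support_monomial_subset hb), hsupp]
      exact hσ.1.2
    have h1 := Module.mem_annihilator.1 ha
      (Submodule.mkQ ((nonfaceIdeal k Ψ.Δ).submoduleOf (nonfaceIdeal k Ψ.Γ)) ⟨xσ, hx⟩)
    have h2 : a * xσ ∈ nonfaceIdeal k Ψ.Δ := by
      rw [← map_smul] at h1
      have h3 : a • (⟨xσ, hx⟩ : nonfaceIdeal k Ψ.Γ) ∈
          (nonfaceIdeal k Ψ.Δ).submoduleOf (nonfaceIdeal k Ψ.Γ) :=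
        (Submodule.Quotient.mk_eq_zero _).1 h1
      exact h3
    refine mem_facePrime.2 fun b hb hbσ => ?_
    refine mem_nonfaceIdeal.1 h2 (b + ∑ v ∈ σ, Finsupp.single v 1) ?_ ?_
    · rw [mem_support_iff, coeff_mul_monomial, mul_one]
      exact mem_support_iff.1 hb
    · refine Ψ.Δ.lower ?_ hσ.1.1
      refine (Finsupp.support_add).trans (Finset.union_subset hbσ hsupp.subset)
  -- The irrelevant ideal is a minimal prime over `Φ` together with the variables outside `σ`, so
  -- Krull's height theorem bounds `|V|` by `Φ.length + |V \ σ|`.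
  let s : Finset (MvPolynomial V k) := Φ.toFinset ∪ (σᶜ).image X
  have hs : Ideal.span (s : Set (MvPolynomial V k)) = Ideal.ofList Φ ⊔ facePrime k σ := by
    simp only [s, Finset.coe_union, Ideal.span_union, Ideal.ofList, facePrime, Finset.coe_image,
      List.coe_toFinset]
    congr 4
    ext v
    simp
  have hmin : irrelevantIdeal V k ∈
      (Ideal.span (s : Set (MvPolynomial V k))).minimalPrimes := by
    refine ⟨⟨inferInstance, ?_⟩, ?_⟩
    · rw [hs, sup_le_iff, Ideal.ofList, facePrime, Ideal.span_le, Ideal.span_le]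
      refine ⟨fun φ hφ => ?_, ?_⟩
      · obtain ⟨e, he, hφe⟩ := hΦ φ hφ
        exact mem_irrelevantIdeal_of_isHomogeneous he hφe
      · rintro _ ⟨v, -, rfl⟩
        exact mem_irrelevantIdeal_of_isHomogeneous one_pos (isHomogeneous_X k v)
    · rintro q ⟨hq, hle⟩ hqm
      rw [hs, sup_le_iff] at hle
      have hmax := isMaximal_of_finite_quotient (k := k) (Ideal.ofList Φ) hfin q
        (hann.trans hle.2) hle.1
      exact (hmax.eq_of_le (Ideal.IsPrime.ne_top inferInstance) hqm).ge
  have h1 := (card_le_height_irrelevantIdeal (k := k) (V := V)).trans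
    (Ideal.height_le_card_of_mem_minimalPrimes_span_finset hmin)
  have h2 : s.card ≤ Φ.length + σᶜ.card :=
    (Finset.card_union_le _ _).trans (add_le_add (List.toFinset_card_le _) Finset.card_image_le)
  have h3 : Fintype.card V ≤ s.card := by exact_mod_cast h1
  have h4 := Finset.card_add_card_compl σ
  omega

variable (k) in
/-- For generic linear forms `Θ` the coordinate ring of each facet is generated by `Θ`. -/
theorem exists_generic_linearForms [Fintype V] (Ψ : RelComplex V) (n : ℕ)
    (hcard : ∀ σ, Maximal (· ∈ Ψ.faces) σ → σ.card = n) :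
    ∃ p : MvPolynomial (Fin n × Ψ.Δ.Vertex) k, p ≠ 0 ∧ ∀ c, eval c p ≠ 0 →
      ∀ σ, Maximal (· ∈ Ψ.faces) σ → ∀ v,
        ∃ s ∈ Algebra.adjoin k {θ | θ ∈ linearForms Ψ.Δ n c},
          (X v : MvPolynomial V k) - s ∈ facePrime k σ := by
  classical
  let F := {σ // Maximal (· ∈ Ψ.faces) σ}
  have hF : Fintype F := Fintype.ofFinite F
  let e : ∀ σ : F, Fin n ≃ {v // v ∈ σ.1} := fun σ =>
    (finCongr (hcard σ.1 σ.2).symm).trans σ.1.equivFin.symm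
  let u : ∀ σ : F, Fin n → Ψ.Δ.Vertex := fun σ j =>
    ⟨(e σ j).1, Ψ.Δ.lower (Finset.singleton_subset_iff.2 (e σ j).2) σ.2.1.1⟩
  have hu : ∀ σ, Function.Injective (u σ) := fun σ i j hij => (e σ).injective
    (Subtype.ext (congrArg (fun w : Ψ.Δ.Vertex => w.1) hij))
  -- The generic coefficient matrix restricted to the columns of the facet `σ`; the required
  -- polynomial is the product of these minors.
  let N : ∀ σ : F, Matrix (Fin n) (Fin n) (MvPolynomial (Fin n × Ψ.Δ.Vertex) k) := fun σ =>
    Matrix.of fun i j => X (i, u σ j)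
  have hN : ∀ σ, (N σ).det ≠ 0 := by
    intro σ
    have h1 : N σ = (rename (R := k) (Prod.map id (u σ))).mapMatrix
        (Matrix.mvPolynomialX (Fin n) (Fin n) k) := by
      ext1 i j
      simp [N]
    rw [h1, ← AlgHom.map_det]
    exact (map_ne_zero_iff _ (rename_injective _ (Function.injective_id.prodMap (hu σ)))).2
      (Matrix.det_mvPolynomialX_ne_zero (Fin n) k)
  refine ⟨∏ σ, (N σ).det, Finset.prod_ne_zero_iff.2 fun σ _ => hN σ, fun c hc σ hσ v => ?_⟩
  by_cases hv : v ∈ σ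
  swap
  · refine ⟨0, zero_mem _, ?_⟩
    rw [sub_zero]
    exact Ideal.subset_span ⟨v, hv, rfl⟩
  rw [map_prod] at hc
  have hdet := Finset.prod_ne_zero_iff.1 hc ⟨σ, hσ⟩ (Finset.mem_univ _)
  let B : Matrix (Fin n) (Fin n) k := Matrix.of fun i j => c (i, u ⟨σ, hσ⟩ j)
  have hB : B.det ≠ 0 := by
    rw [RingHom.map_det] at hdet
    convert hdet using 2
    ext i j
    simp [B, N]
  have hBB : B⁻¹ * B = 1 := Matrix.nonsing_inv_mul B (isUnit_iff_ne_zero.2 hB)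
  let j₀ : Fin n := (e ⟨σ, hσ⟩).symm ⟨v, hv⟩
  have hj₀ : (u ⟨σ, hσ⟩ j₀).1 = v := by simp [u, j₀]
  -- Row `j₀` of `B⁻¹` solves for `X v` in terms of `Θ`; the error involves only variables outside
  -- `σ`.
  refine ⟨∑ i, B⁻¹ j₀ i • ∑ w : Ψ.Δ.Vertex, C (c (i, w)) * X w.1,
    sum_mem fun i _ => Subalgebra.smul_mem _ (Algebra.subset_adjoin ?_) _, ?_⟩
  · rw [Set.mem_ofPred_eq, linearForms, List.mem_ofFn]
    exact ⟨i, rfl⟩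
  have h1 : (X v : MvPolynomial V k) - ∑ i, B⁻¹ j₀ i • ∑ w : Ψ.Δ.Vertex, C (c (i, w)) * X w.1 =
      ∑ w : Ψ.Δ.Vertex,
        C ((if w = u ⟨σ, hσ⟩ j₀ then 1 else 0) - ∑ i, B⁻¹ j₀ i * c (i, w)) * X w.1 := by
    simp only [C_sub, sub_mul, Finset.sum_sub_distrib, smul_eq_C_mul, Finset.mul_sum]
    congr 1
    · simp [hj₀]
    · rw [Finset.sum_comm]
      refine Finset.sum_congr rfl fun w _ => ?_
      rw [map_sum, Finset.sum_mul]
      exact Finset.sum_congr rfl fun i _ => by rw [C_mul, mul_assoc]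
  rw [h1]
  refine sum_mem fun w _ => ?_
  by_cases hw : w.1 ∈ σ
  · obtain ⟨j, hj⟩ : ∃ j, u ⟨σ, hσ⟩ j = w :=
      ⟨(e ⟨σ, hσ⟩).symm ⟨w.1, hw⟩, Subtype.ext (by simp [u])⟩
    have h2 : ∑ i, B⁻¹ j₀ i * c (i, w) = (B⁻¹ * B) j₀ j := by
      simp [Matrix.mul_apply, B, hj]
    have h3 : (w = u ⟨σ, hσ⟩ j₀) ↔ j₀ = j := by
      rw [← hj]
      exact ⟨fun h => (hu _ h).symm, fun h => by rw [h]⟩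
    rw [h2, hBB, Matrix.one_apply]
    simp [h3]
  · exact Ideal.mul_mem_left _ _ (Ideal.subset_span ⟨w.1, hw, rfl⟩)

end Parameters

/-! ### Linear algebra of a graded complex under successive parameters. -/

section GradedComplex

open Module

variable {k E : Type*} [Field k] [AddCommGroup E] [Module k E]

/-- Rank–nullity for the map from `S` to `E' / U` induced by `f`, phrased without quotients. -/
theorem finrank_sup_map_add_finrank_inf_comap {E' : Type*} [AddCommGroup E'] [Module k E']
    (f : E →ₗ[k] E') (S : Submodule k E) (U : Submodule k E') [FiniteDimensional k S]
    [FiniteDimensional k U] :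
    finrank k ↥(U ⊔ S.map f) + finrank k ↥(S ⊓ U.comap f) = finrank k U + finrank k S := by
  have hmap : ∀ T : Submodule k E, FiniteDimensional k T →
      finrank k ↥(T.map f) + finrank k ↥(T ⊓ LinearMap.ker f) = finrank k T := by
    intro T hT
    have h1 := LinearMap.finrank_range_add_finrank_ker (f.domRestrict T)
    have h2 : LinearMap.range (f.domRestrict T) = T.map f := by
      rw [LinearMap.range_domRestrict]
    have h3 : finrank k (LinearMap.ker (f.domRestrict T)) = finrank k ↥(T ⊓ LinearMap.ker f) := by
      rw [LinearMap.ker_domRestrict, ← Submodule.map_comap_subtype]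
      exact (LinearEquiv.finrank_eq (Submodule.equivMapOfInjective T.subtype
        T.injective_subtype _))
    rw [h2, h3] at h1
    exact h1
  have h1 := Submodule.finrank_sup_add_finrank_inf_eq U (S.map f)
  have h2 := hmap S inferInstance
  have h3 := hmap (S ⊓ U.comap f) inferInstance
  have h4 : (S ⊓ U.comap f).map f = U ⊓ S.map f := by
    ext y
    constructor
    · rintro ⟨x, ⟨h1, h2⟩, rfl⟩
      exact ⟨h2, x, h1, rfl⟩
    · rintro ⟨h1, x, h2, rfl⟩
      exact ⟨x, ⟨h2, h1⟩, rfl⟩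
  have h5 : S ⊓ U.comap f ⊓ LinearMap.ker f = S ⊓ LinearMap.ker f := by
    ext x
    simp only [Submodule.mem_inf, Submodule.mem_comap, LinearMap.mem_ker]
    constructor
    · rintro ⟨⟨h1, -⟩, h3⟩
      exact ⟨h1, h3⟩
    · rintro ⟨h1, h3⟩
      exact ⟨⟨h1, h3 ▸ U.zero_mem⟩, h3⟩
  rw [h4, h5] at h3
  omega

/-- The cocycles of the quotient complex `X / N`, as elements of `X`. -/
def relCocycles (d : E →ₗ[k] E) (X N : ℤ → ℤ → Submodule k E) (i j : ℤ) : Submodule k E :=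
  X i j ⊓ (N (i + 1) j).comap d

/-- The coboundaries of the quotient complex `X / N`, as elements of `X`. -/
def relCoboundaries (d : E →ₗ[k] E) (X N : ℤ → ℤ → Submodule k E) (i j : ℤ) : Submodule k E :=
  N i j ⊔ (X (i - 1) j).map d

/-- The dimension of the cohomology of `X / N` in cohomological degree `i` and internal
degree `j`. -/
def relBetti (d : E →ₗ[k] E) (X N : ℤ → ℤ → Submodule k E) (i j : ℤ) : ℤ :=
  finrank k (relCocycles d X N i j) - finrank k (relCoboundaries d X N i j)

/-- A graded complex `X / N` with an operator `θ` of degree one that acts as zero on the cohomology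
in nonnegative degrees and is injective on the terms in positive degrees. -/
structure IsParameterStep (d θ : E →ₗ[k] E) (X N : ℤ → ℤ → Submodule k E) : Prop where
  finite : ∀ i j, FiniteDimensional k (X i j)
  le : ∀ i j, N i j ≤ X i j
  d_mem_X : ∀ i j, ∀ x ∈ X i j, d x ∈ X (i + 1) j
  d_mem_N : ∀ i j, ∀ x ∈ N i j, d x ∈ N (i + 1) j
  smul_mem_N : ∀ i j, ∀ x ∈ N i j, θ x ∈ N i (j + 1)
  d_d : ∀ x, d (d x) = 0
  comm : ∀ x, d (θ x) = θ (d x)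
  injective : ∀ i j, 1 ≤ i → ∀ x ∈ X i j, θ x ∈ N i (j + 1) → x ∈ N i j
  kills : ∀ i j, 0 ≤ i → ∀ x ∈ relCocycles d X N i j, θ x ∈ relCoboundaries d X N i (j + 1)

namespace IsParameterStep

variable {d θ : E →ₗ[k] E} {X N : ℤ → ℤ → Submodule k E} (h : IsParameterStep d θ X N)

include h

/-- If `θ x` is a coboundary modulo `N`, then `θ (d x) ∈ N`; as `d x` sits in position at least 1,
injectivity gives `d x ∈ N`. The converse is `kills`. -/
theorem inf_comap_relCoboundaries {i : ℤ} (hi : 0 ≤ i) (j : ℤ) :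
    X i (j - 1) ⊓ (relCoboundaries d X N i j).comap θ = relCocycles d X N i (j - 1) := by
  refine le_antisymm ?_ ?_
  · rintro x ⟨hx, hθx⟩
    refine ⟨hx, ?_⟩
    refine h.injective (i + 1) (j - 1) (by omega) _ (h.d_mem_X _ _ _ hx) ?_
    rw [← h.comm, sub_add_cancel]
    obtain ⟨y, hy, z, hz, hyz⟩ := Submodule.mem_sup.1 hθx
    obtain ⟨w, -, rfl⟩ := hz
    rw [← hyz, map_add, h.d_d, add_zero]
    exact h.d_mem_N _ _ _ hy
  · intro x hx
    refine ⟨hx.1, ?_⟩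
    have := h.kills i (j - 1) hi x hx
    rwa [sub_add_cancel] at this

theorem inf_comap_N {i : ℤ} (hi : 1 ≤ i) (j : ℤ) :
    X i (j - 1) ⊓ (N i j).comap θ = N i (j - 1) := by
  refine le_antisymm ?_ ?_
  · rintro x ⟨hx, hθx⟩
    refine h.injective i (j - 1) hi x hx ?_
    rwa [sub_add_cancel]
  · intro x hx
    refine ⟨h.le _ _ hx, ?_⟩
    have := h.smul_mem_N i (j - 1) x hx
    rwa [sub_add_cancel] at this

variable {N' : ℤ → ℤ → Submodule k E} (hN' : ∀ i j, N' i j = N i j ⊔ (X i (j - 1)).map θ)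

include hN'

/-- Dividing by `θ` changes the Betti numbers by Pascal's rule. -/
theorem relBetti_succ {i : ℤ} (hi : 0 ≤ i) (j : ℤ) :
    relBetti d X N' i j = relBetti d X N i j + relBetti d X N (i + 1) (j - 1) := by
  have hX := h.finite
  have hN : ∀ i j, FiniteDimensional k (N i j) := fun i j =>
    Submodule.finiteDimensional_of_le (h.le i j)
  have hN'f : ∀ i j, FiniteDimensional k (N' i j) := fun i j => by
    rw [hN']
    infer_instance
  have hB : ∀ i j, FiniteDimensional k (relCoboundaries d X N i j) := fun i j => by
    rw [relCoboundaries]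
    infer_instance
  -- These six rank counts replace the long exact sequence of `θ` with its zero maps on cohomology.
  -- Injectivity modulo `N` enters only in position `i + 1`, so position 0 needs none.
  have e1 := finrank_sup_map_add_finrank_inf_comap d (X i j) (N (i + 1) j)
  have e2 := finrank_sup_map_add_finrank_inf_comap d (X i j) (N' (i + 1) j)
  have e3 := finrank_sup_map_add_finrank_inf_comap θ (X (i + 1) (j - 1)) (N (i + 1) j)
  have e4 := finrank_sup_map_add_finrank_inf_comap θ (X (i + 1) (j - 1))
    (relCoboundaries d X N (i + 1) j)
  have e5 := finrank_sup_map_add_finrank_inf_comap θ (X i (j - 1)) (relCoboundaries d X N i j)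
  have e6 := finrank_sup_map_add_finrank_inf_comap d (X i (j - 1)) (N (i + 1) (j - 1))
  rw [h.inf_comap_relCoboundaries (by omega)] at e4
  rw [h.inf_comap_relCoboundaries hi] at e5
  rw [h.inf_comap_N (by omega), ← hN'] at e3
  have i1 : N' (i + 1) j ⊔ (X i j).map d =
      relCoboundaries d X N (i + 1) j ⊔ (X (i + 1) (j - 1)).map θ := by
    rw [hN', relCoboundaries, add_sub_cancel_right, sup_right_comm]
  have i2 : N (i + 1) j ⊔ (X i j).map d = relCoboundaries d X N (i + 1) j := by
    rw [relCoboundaries, add_sub_cancel_right]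
  have i3 : relCoboundaries d X N' i j = relCoboundaries d X N i j ⊔ (X i (j - 1)).map θ := by
    rw [relCoboundaries, hN', relCoboundaries, sup_right_comm]
  have i4 : N (i + 1) (j - 1) ⊔ (X i (j - 1)).map d = relCoboundaries d X N (i + 1) (j - 1) := by
    rw [relCoboundaries, add_sub_cancel_right]
  have z1 : X i j ⊓ (N (i + 1) j).comap d = relCocycles d X N i j := rfl
  have z2 : X i j ⊓ (N' (i + 1) j).comap d = relCocycles d X N' i j := rfl
  have z3 : X i (j - 1) ⊓ (N (i + 1) (j - 1)).comap d = relCocycles d X N i (j - 1) := rfl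
  rw [i2, z1] at e1
  rw [i1, z2] at e2
  rw [← i3] at e5
  rw [i4, z3] at e6
  unfold relBetti
  omega

/-- The dimension of the term in degree zero, after dividing by `θ`. -/
theorem finrank_sub_finrank_succ (hneg : ∀ j, X (-1) j = ⊥) (j : ℤ) :
    (finrank k (X 0 j) : ℤ) - finrank k (N' 0 j) =
      (finrank k (X 0 j) - finrank k (N 0 j)) -
        (finrank k (X 0 (j - 1)) - finrank k (N 0 (j - 1))) + relBetti d X N 0 (j - 1) := by
  have hX := h.finite
  have hN : ∀ i j, FiniteDimensional k (N i j) := fun i j =>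
    Submodule.finiteDimensional_of_le (h.le i j)
  -- Position 0 has no incoming coboundaries, so the kernel of `θ` there is exactly the space of
  -- cocycles.
  have hB : ∀ j, relCoboundaries d X N 0 j = N 0 j := fun j => by
    rw [relCoboundaries, zero_sub, hneg, Submodule.map_bot, sup_bot_eq]
  have e1 := finrank_sup_map_add_finrank_inf_comap θ (X 0 (j - 1)) (N 0 j)
  have e2 := h.inf_comap_relCoboundaries le_rfl j
  rw [hB] at e2
  rw [e2, ← hN'] at e1
  rw [relBetti, hB]
  omega

end IsParameterStep

/-- The Betti numbers and the Hilbert function of a graded complex after dividing by `r` parameters,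
when the cohomology of the complex is concentrated in internal degree zero. -/
theorem relBetti_and_finrank_of_isParameterStep (d : E →ₗ[k] E) (θ : ℕ → E →ₗ[k] E)
    (X : ℤ → ℤ → Submodule k E) (N : ℕ → ℤ → ℤ → Submodule k E) (n : ℕ)
    (hstep : ∀ r < n, IsParameterStep d (θ r) X (N r))
    (hN : ∀ r < n, ∀ i j, N (r + 1) i j = N r i j ⊔ (X i (j - 1)).map (θ r))
    (hneg : ∀ j, X (-1) j = ⊥) (hneg' : ∀ r i j, j < 0 → relBetti d X (N r) i j = 0)
    (hcneg : ∀ r j, j < 0 → (finrank k (X 0 j) : ℤ) - finrank k (N r 0 j) = 0)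
    (h0 : ∀ i j, 0 ≤ i → 0 < j → relBetti d X (N 0) i j = 0) (r : ℕ) (hr : r ≤ n) :
    (∀ i j : ℕ, relBetti d X (N r) i j = r.choose j * relBetti d X (N 0) (i + j : ℕ) 0) ∧
    ∀ j : ℕ, (finrank k (X 0 j) : ℤ) - finrank k (N r 0 j) =
      PowerSeries.coeff j ((1 - PowerSeries.X) ^ r *
        PowerSeries.mk fun m : ℕ => (finrank k (X 0 m) : ℤ) - finrank k (N 0 0 m)) +
      r.choose j * ∑ m ∈ Finset.range j, (-1) ^ (m + 1 + j) * relBetti d X (N 0) m 0 := by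
  induction r with
  | zero =>
    refine ⟨fun i j => ?_, fun j => ?_⟩
    · cases j with
      | zero => simp
      | succ j => simpa using h0 i (j + 1) (by positivity) (by positivity)
    · cases j <;> simp
  | succ r ih =>
    obtain ⟨ih1, ih2⟩ := ih (by omega)
    have hs := hstep r (by omega)
    have hN' := hN r (by omega)
    refine ⟨fun i j => ?_, fun j => ?_⟩
    · rw [hs.relBetti_succ hN' (by positivity)]
      cases j with
      | zero =>
        -- With integer indices `j - 1` is not truncated: here it is `-1`, where everything
        -- vanishes.
        rw [hneg' r (i + 1) ((0 : ℕ) - 1) (by simp), ih1]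
        simp
      | succ j =>
        have e : ((j + 1 : ℕ) : ℤ) - 1 = j := by push_cast; ring
        rw [e, ih1, show (i : ℤ) + 1 = ((i + 1 : ℕ) : ℤ) by push_cast; ring, ih1,
          Nat.choose_succ_succ, show i + 1 + j = i + (j + 1) by ring]
        push_cast
        ring
    · rw [hs.finrank_sub_finrank_succ hN' hneg, pow_succ', mul_assoc]
      cases j with
      | zero =>
        rw [hcneg r ((0 : ℕ) - 1) (by simp), hneg' r 0 ((0 : ℕ) - 1) (by simp), ih2]
        simp [sub_mul, PowerSeries.coeff_zero_eq_constantCoeff]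
      | succ j =>
        have e : ((j + 1 : ℕ) : ℤ) - 1 = j := by push_cast; ring
        rw [e, ih2, ih2, sub_mul, one_mul, map_sub, PowerSeries.coeff_succ_X_mul]
        have h1 := ih1 0 j
        simp only [Nat.cast_zero, zero_add] at h1
        -- The kernel term `b_r(0, j)` supplies the new summand `m = j`, whose sign is `+1`;
        -- Pascal's rule combines the others.
        rw [h1, Finset.sum_range_succ, Nat.choose_succ_succ]
        have h2 : ∑ m ∈ Finset.range j, (-1 : ℤ) ^ (m + 1 + (j + 1)) * relBetti d X (N 0) m 0 =
            - ∑ m ∈ Finset.range j, (-1 : ℤ) ^ (m + 1 + j) * relBetti d X (N 0) m 0 := by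
          rw [← Finset.sum_neg_distrib]
          exact Finset.sum_congr rfl fun m _ => by ring
        have h3 : (-1 : ℤ) ^ (j + 1 + (j + 1)) = 1 := Even.neg_one_pow ⟨_, rfl⟩
        rw [h2, h3]
        push_cast
        ring

end GradedComplex

/-! ### Homogeneous pieces of ideals and of families of polynomials. -/

section GradedPieces

open Module

attribute [local instance] MvPolynomial.gradedAlgebra

variable {V : Type*} {k : Type*} [Field k]

/-- The homogeneous elements of degree `j` of an ideal. -/
def gradedPiece (K : Ideal (MvPolynomial V k)) (j : ℤ) : Submodule k (MvPolynomial V k) :=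
  K.restrictScalars k ⊓ restrictSupport k {a | (a.degree : ℤ) = j}

theorem mem_gradedPiece {K : Ideal (MvPolynomial V k)} {j : ℤ} {f : MvPolynomial V k} :
    f ∈ gradedPiece K j ↔ f ∈ K ∧ ∀ a ∈ f.support, (a.degree : ℤ) = j := Iff.rfl

theorem mem_gradedPiece_natCast {K : Ideal (MvPolynomial V k)} {j : ℕ} {f : MvPolynomial V k} :
    f ∈ gradedPiece K j ↔ f ∈ K ∧ f.IsHomogeneous j := by
  rw [mem_gradedPiece, IsHomogeneous, IsWeightedHomogeneous]
  simp only [Finsupp.degree_eq_weight_one, MvPolynomial.mem_support_iff, Nat.cast_inj]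
  exact Iff.rfl

theorem gradedPiece_of_neg (K : Ideal (MvPolynomial V k)) {j : ℤ} (hj : j < 0) :
    gradedPiece K j = ⊥ := by
  refine (Submodule.eq_bot_iff _).2 fun f hf => ?_
  rw [← MvPolynomial.support_eq_empty, Finset.eq_empty_iff_forall_notMem]
  intro a ha
  have := (mem_gradedPiece.1 hf).2 a ha
  omega

instance [Finite V] (K : Ideal (MvPolynomial V k)) (j : ℤ) :
    FiniteDimensional k (gradedPiece K j) := by
  have hfin : Finite {a : V →₀ ℕ | (a.degree : ℤ) = j} := by
    refine Set.finite_coe_iff.2 ((Finsupp.finite_of_degree_eq (σ := V) j.toNat).subset ?_)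
    intro a ha
    have : (a.degree : ℤ) = j := ha
    change a.degree = j.toNat
    omega
  have : FiniteDimensional k (restrictSupport k {a : V →₀ ℕ | (a.degree : ℤ) = j}) :=
    Module.Finite.of_basis (basisRestrictSupport k _)
  exact Submodule.finiteDimensional_of_le inf_le_right

theorem gradedPiece_mono {K L : Ideal (MvPolynomial V k)} (h : K ≤ L) (j : ℤ) :
    gradedPiece K j ≤ gradedPiece L j :=
  inf_le_inf_right _ h

theorem mul_mem_gradedPiece {K L : Ideal (MvPolynomial V k)} {j : ℤ} {θ f : MvPolynomial V k}
    (hθ : θ.IsHomogeneous 1) (hf : f ∈ gradedPiece K j) (h : θ * f ∈ L) :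
    θ * f ∈ gradedPiece L (j + 1) := by
  obtain hj | hj := lt_or_ge j 0
  · rw [gradedPiece_of_neg K hj, Submodule.mem_bot] at hf
    rw [hf, mul_zero]
    exact zero_mem _
  · lift j to ℕ using hj
    have h1 := (mem_gradedPiece_natCast.1 hf).2
    have h2 : ((j : ℤ) + 1) = ((1 + j : ℕ) : ℤ) := by push_cast; ring
    rw [h2]
    exact mem_gradedPiece_natCast.2 ⟨h, hθ.mul h1⟩

/-- Homogeneous ideals contain the components of their elements, and multiplication by `θ` shifts
components by one; in degree 0 it contributes nothing. -/
theorem gradedPiece_sup_span_mul {K L : Ideal (MvPolynomial V k)}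
    (hK : K.IsHomogeneous (homogeneousSubmodule V k))
    (hL : L.IsHomogeneous (homogeneousSubmodule V k)) {θ : MvPolynomial V k}
    (hθ : θ.IsHomogeneous 1) (j : ℤ) :
    gradedPiece (K ⊔ Ideal.span {θ} * L) j =
      gradedPiece K j ⊔ (gradedPiece L (j - 1)).map (LinearMap.mulLeft k θ) := by
  refine le_antisymm ?_ (sup_le (gradedPiece_mono le_sup_left j) ?_)
  · intro f hf
    obtain hj | hj := lt_or_ge j 0
    · rw [gradedPiece_of_neg _ hj, Submodule.mem_bot] at hf
      rw [hf]
      exact zero_mem _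
    lift j to ℕ using hj
    obtain ⟨hf1, hf2⟩ := mem_gradedPiece_natCast.1 hf
    obtain ⟨a, ha, b', hb', rfl⟩ := Submodule.mem_sup.1 hf1
    obtain ⟨b, hb, rfl⟩ := Ideal.mem_span_singleton_mul.1 hb'
    rw [← homogeneousComponent_eq_self hf2, map_add]
    refine add_mem (Submodule.mem_sup_left (mem_gradedPiece_natCast.2
      ⟨homogeneousComponent_mem_of_mem hK ha j, homogeneousComponent_isHomogeneous j a⟩)) ?_
    have hdec := decomposition.decompose'_apply (R := k) (σ := V)
    obtain _ | j := j
    · have := DirectSum.coe_decompose_mul_of_left_mem_of_not_le (homogeneousSubmodule V k) (b := b)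
        (n := 0) (i := 1) hθ (by omega)
      have h2 : homogeneousComponent 0 (θ * b) = 0 := by
        rw [← hdec]
        exact this
      rw [h2]
      exact zero_mem _
    · have := DirectSum.coe_decompose_mul_of_left_mem_of_le (homogeneousSubmodule V k) (b := b)
        (n := j + 1) (i := 1) hθ (by omega)
      have h2 : homogeneousComponent (j + 1) (θ * b) = θ * homogeneousComponent j b := by
        rw [← hdec, ← hdec]
        exact this
      rw [h2]
      refine Submodule.mem_sup_right ⟨homogeneousComponent j b, ?_, rfl⟩
      have h3 : (((j + 1 : ℕ) : ℤ) - 1) = (j : ℕ) := by push_cast; ring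
      rw [h3]
      exact mem_gradedPiece_natCast.2
        ⟨homogeneousComponent_mem_of_mem hL hb j, homogeneousComponent_isHomogeneous j b⟩
  · rintro _ ⟨b, hb, rfl⟩
    have := mul_mem_gradedPiece (L := K ⊔ Ideal.span {θ} * L) hθ hb
      (Submodule.mem_sup_right (Ideal.mul_mem_mul (Ideal.mem_span_singleton_self θ) hb.1))
    rwa [sub_add_cancel] at this

/-- The families of polynomials `f`, supported on the sets with `i` elements, such that `f τ` is
homogeneous of degree `j` and lies in the ideal `K τ`. -/
def polyCochains (K : Finset V → Ideal (MvPolynomial V k)) (i j : ℤ) :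
    Submodule k (Finset V → MvPolynomial V k) where
  carrier := {f | ∀ τ, f τ ∈ gradedPiece (K τ) j ∧ ((τ.card : ℤ) ≠ i → f τ = 0)}
  add_mem' hf hg τ := ⟨add_mem (hf τ).1 (hg τ).1, fun h => by
    rw [Pi.add_apply, (hf τ).2 h, (hg τ).2 h, add_zero]⟩
  zero_mem' τ := ⟨zero_mem _, fun _ => rfl⟩
  smul_mem' c f hf τ := ⟨Submodule.smul_mem _ c (hf τ).1, fun h => by
    rw [Pi.smul_apply, (hf τ).2 h, smul_zero]⟩

theorem finiteDimensional_polyCochains [Finite V] (K : Finset V → Ideal (MvPolynomial V k))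
    (i j : ℤ) : FiniteDimensional k (polyCochains K i j) := by
  let g : polyCochains K i j →ₗ[k] (∀ τ, gradedPiece (K τ) j) :=
    LinearMap.pi fun τ => ((LinearMap.proj τ).comp (polyCochains K i j).subtype).codRestrict _
      fun f => (f.2 τ).1
  exact FiniteDimensional.of_injective g fun f f' h => Subtype.ext <| funext fun τ =>
    congrArg Subtype.val (congrFun h τ)

theorem polyCochains_mono {K L : Finset V → Ideal (MvPolynomial V k)} (h : ∀ τ, K τ ≤ L τ)
    (i j : ℤ) : polyCochains K i j ≤ polyCochains L i j := fun _ hf τ =>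
  ⟨gradedPiece_mono (h τ) j (hf τ).1, (hf τ).2⟩

theorem polyCochains_of_neg_left (K : Finset V → Ideal (MvPolynomial V k)) {i : ℤ} (hi : i < 0)
    (j : ℤ) : polyCochains K i j = ⊥ :=
  (Submodule.eq_bot_iff _).2 fun _ hf => funext fun τ => (hf τ).2 (by omega)

theorem polyCochains_of_neg_right (K : Finset V → Ideal (MvPolynomial V k)) (i : ℤ) {j : ℤ}
    (hj : j < 0) : polyCochains K i j = ⊥ :=
  (Submodule.eq_bot_iff _).2 fun _ hf => funext fun τ => by
    have := (hf τ).1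
    rwa [gradedPiece_of_neg _ hj, Submodule.mem_bot] at this

theorem smul_mem_polyCochains {K L : Finset V → Ideal (MvPolynomial V k)} {i j : ℤ}
    {f : Finset V → MvPolynomial V k} (hf : f ∈ polyCochains K i j) {θ : MvPolynomial V k}
    (hθ : θ.IsHomogeneous 1) (h : ∀ τ, θ * f τ ∈ L τ) : θ • f ∈ polyCochains L i (j + 1) :=
  fun τ => ⟨mul_mem_gradedPiece hθ (hf τ).1 (h τ), fun hτ => by
    rw [Pi.smul_apply, (hf τ).2 hτ, smul_zero]⟩

end GradedPieces

/-! ### The coboundary and its cone homotopies. -/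

section PartitionComplex

open Module

variable {V : Type*} [LinearOrder V] {k : Type*} [Field k]

theorem faceSign_mul_self (τ : Finset V) (v : V) : faceSign k τ v * faceSign k τ v = 1 := by
  rw [faceSign, ← mul_pow]
  simp

theorem faceSign_mul_faceSign_erase_of_lt {τ : Finset V} {v w : V} (hv : v ∈ τ) (hvw : v < w) :
    faceSign k τ w * faceSign k (τ.erase w) v =
      -(faceSign k τ v * faceSign k (τ.erase v) w) := by
  have h1 : (τ.erase w).filter (· < v) = τ.filter (· < v) := by
    rw [Finset.filter_erase, Finset.erase_eq_of_notMem]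
    simp [hvw.le]
  have h2 : ((τ.erase v).filter (· < w)).card + 1 = (τ.filter (· < w)).card := by
    rw [Finset.filter_erase, Finset.card_erase_add_one]
    simp [hv, hvw]
  rw [faceSign, faceSign, faceSign, faceSign, h1, ← h2]
  ring

theorem faceSign_mul_faceSign_erase {τ : Finset V} {v w : V} (hv : v ∈ τ) (hw : w ∈ τ)
    (hvw : v ≠ w) :
    faceSign k τ w * faceSign k (τ.erase w) v =
      -(faceSign k τ v * faceSign k (τ.erase v) w) := by
  obtain h | h := lt_or_gt_of_ne hvw
  · exact faceSign_mul_faceSign_erase_of_lt hv h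
  · rw [faceSign_mul_faceSign_erase_of_lt hw h, neg_neg]

variable (V k) in
/-- The coboundary on families of polynomials indexed by the finite subsets of `V`. -/
def polyCoboundary : (Finset V → MvPolynomial V k) →ₗ[MvPolynomial V k]
    (Finset V → MvPolynomial V k) where
  toFun f τ := ∑ v ∈ τ, faceSign k τ v • f (τ.erase v)
  map_add' f g := by
    funext τ
    simp [Finset.sum_add_distrib]
  map_smul' c f := by
    funext τ
    simp [Finset.mul_sum]

theorem polyCoboundary_apply (f : Finset V → MvPolynomial V k) (τ : Finset V) :
    polyCoboundary V k f τ = ∑ v ∈ τ, faceSign k τ v • f (τ.erase v) := rfl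

variable (V k) in
/-- The coboundary as a linear map over `k`. -/
def scalarCoboundary :
    (Finset V → MvPolynomial V k) →ₗ[k] (Finset V → MvPolynomial V k) :=
  (polyCoboundary V k).restrictScalars k

theorem scalarCoboundary_apply (f : Finset V → MvPolynomial V k) :
    scalarCoboundary V k f = polyCoboundary V k f := rfl

variable (k) in
/-- The contraction of cochains with the vertex `v`. -/
def contraction (v : V) : (Finset V → MvPolynomial V k) →ₗ[MvPolynomial V k]
    (Finset V → MvPolynomial V k) where
  toFun f τ := if v ∈ τ then 0 else faceSign k (insert v τ) v • f (insert v τ)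
  map_add' f g := by
    funext τ
    simp only [Pi.add_apply]
    split_ifs <;> simp
  map_smul' c f := by
    funext τ
    simp only [Pi.smul_apply, RingHom.id_apply]
    split_ifs <;> simp

theorem contraction_apply (v : V) (f : Finset V → MvPolynomial V k) (τ : Finset V) :
    contraction k v f τ = if v ∈ τ then 0 else faceSign k (insert v τ) v • f (insert v τ) := rfl

/-- On the full simplex, contraction with `v` is the cone homotopy from the identity to zero.
Cohomology of the partition complex arises because contraction need not preserve the face ideals. -/
theorem polyCoboundary_contraction_add (v : V) (f : Finset V → MvPolynomial V k) :
    polyCoboundary V k (contraction k v f) + contraction k v (polyCoboundary V k f) = f := by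
  funext τ
  rw [Pi.add_apply, polyCoboundary_apply, contraction_apply]
  by_cases hv : v ∈ τ
  · rw [if_pos hv, add_zero, Finset.sum_eq_single v]
    · rw [contraction_apply, if_neg (Finset.notMem_erase v τ), Finset.insert_erase hv, smul_smul,
        faceSign_mul_self, one_smul]
    · intro w _ hwv
      rw [contraction_apply, if_pos (Finset.mem_erase.2 ⟨hwv.symm, hv⟩), smul_zero]
    · exact fun h => absurd hv h
  · rw [if_neg hv, polyCoboundary_apply, Finset.sum_insert hv, Finset.erase_insert hv, smul_add,
      smul_smul, faceSign_mul_self, one_smul, add_left_comm, add_eq_left, Finset.smul_sum,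
      ← Finset.sum_add_distrib]
    refine Finset.sum_eq_zero fun w hw => ?_
    have hwv : w ≠ v := fun h => hv (h ▸ hw)
    rw [contraction_apply, if_neg fun h => hv (Finset.mem_of_mem_erase h), smul_smul, smul_smul,
      ← Finset.erase_insert_of_ne hwv.symm, ← add_smul]
    have h1 := faceSign_mul_faceSign_erase (k := k) (τ := insert v τ) (v := v) (w := w)
      (Finset.mem_insert_self v τ) (Finset.mem_insert_of_mem hw) hwv.symm
    rw [Finset.erase_insert hv] at h1
    have h2 := faceSign_mul_self (k := k) (insert v τ) v
    have h3 := faceSign_mul_self (k := k) ((insert v τ).erase w) v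
    have h4 : faceSign k τ w * faceSign k ((insert v τ).erase w) v +
        faceSign k (insert v τ) v * faceSign k (insert v τ) w = 0 := by
      linear_combination faceSign k (insert v τ) v * faceSign k ((insert v τ).erase w) v * h1 -
        faceSign k (insert v τ) v * faceSign k (insert v τ) w * h3 +
        (- faceSign k τ w * faceSign k ((insert v τ).erase w) v) * h2
    rw [h4, zero_smul]

/-- By the homotopy formula the square of the coboundary commutes with contraction. Its value at `τ`
is therefore, up to sign, a value of the same kind at `τ \ {v}`, and induction on the cardinality
applies. -/
theorem polyCoboundary_polyCoboundary (f : Finset V → MvPolynomial V k) :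
    polyCoboundary V k (polyCoboundary V k f) = 0 := by
  have key : ∀ (n : ℕ) (τ : Finset V), τ.card = n → ∀ f : Finset V → MvPolynomial V k,
      polyCoboundary V k (polyCoboundary V k f) τ = 0 := by
    intro n
    induction n with
    | zero =>
      intro τ hτ f
      rw [Finset.card_eq_zero.1 hτ, polyCoboundary_apply, Finset.sum_empty]
    | succ n ih =>
      intro τ hτ f
      obtain ⟨v, hv⟩ : τ.Nonempty := Finset.card_pos.1 (by omega)
      have h1 := polyCoboundary_contraction_add v (polyCoboundary V k f)
      have h2 := congrArg (polyCoboundary V k) (polyCoboundary_contraction_add v f)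
      have h3 := polyCoboundary_contraction_add v (polyCoboundary V k (polyCoboundary V k f))
      rw [map_add] at h2
      have h4 : contraction k v (polyCoboundary V k (polyCoboundary V k f)) =
          polyCoboundary V k (polyCoboundary V k (contraction k v f)) :=
        (eq_sub_of_add_eq' h1).trans (eq_sub_of_add_eq h2).symm
      have h5 := congrFun h4 (τ.erase v)
      rw [ih _ (by rw [Finset.card_erase_of_mem hv, hτ]; rfl), contraction_apply,
        if_neg (Finset.notMem_erase v τ), Finset.insert_erase hv] at h5
      rw [← one_smul k (polyCoboundary V k (polyCoboundary V k f) τ), ← faceSign_mul_self τ v,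
        mul_smul, h5, smul_zero]
  exact funext fun τ => key _ τ rfl f

theorem polyCoboundary_mem {K : Finset V → Ideal (MvPolynomial V k)}
    (hK : ∀ τ v, K τ ≤ K (insert v τ)) {i j : ℤ} {f : Finset V → MvPolynomial V k}
    (hf : f ∈ polyCochains K i j) : polyCoboundary V k f ∈ polyCochains K (i + 1) j := by
  intro τ
  rw [polyCoboundary_apply]
  constructor
  · refine sum_mem fun v hv => Submodule.smul_mem _ _ ?_
    have h1 := hK (τ.erase v) v
    rw [Finset.insert_erase hv] at h1
    exact gradedPiece_mono h1 j (hf _).1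
  · intro hτ
    refine Finset.sum_eq_zero fun v hv => ?_
    rw [(hf _).2, smul_zero]
    have := Finset.card_erase_add_one hv
    omega

theorem contraction_mem {K : Finset V → Ideal (MvPolynomial V k)} {i j : ℤ} {v : V}
    {f : Finset V → MvPolynomial V k} (hf : f ∈ polyCochains K i j)
    (hv : ∀ τ, f (insert v τ) ∈ K τ) : contraction k v f ∈ polyCochains K (i - 1) j := by
  intro τ
  rw [contraction_apply]
  split_ifs with hvτ
  · exact ⟨zero_mem _, fun _ => rfl⟩
  · refine ⟨Submodule.smul_mem _ _ ⟨hv τ, (hf (insert v τ)).1.2⟩, fun hτ => ?_⟩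
    rw [(hf _).2, smul_zero]
    rw [Finset.card_insert_of_notMem hvτ]
    push_cast
    omega

/-- Multiplication by `X v` is null-homotopic on the partition complex. -/
theorem X_smul_contraction_mem {K : Finset V → Ideal (MvPolynomial V k)} {v : V}
    (hK : ∀ τ, ∀ f ∈ K (insert v τ), X v * f ∈ K τ) {i j : ℤ} {f : Finset V → MvPolynomial V k}
    (hf : f ∈ polyCochains K i j) :
    (X v : MvPolynomial V k) • contraction k v f ∈ polyCochains K (i - 1) (j + 1) := by
  rw [← map_smul]
  exact contraction_mem (smul_mem_polyCochains hf (isHomogeneous_X k v) fun τ =>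
    Ideal.mul_mem_left _ _ (hf τ).1.1) fun τ => hK τ _ (hf _).1.1

/-- Multiply the homotopy formula by `X v`: the contraction of the coboundary of `f` lands in the
`L` part, and the other term is a coboundary. Linearity extends this to all linear forms. -/
theorem smul_mem_relCoboundaries {K L : Finset V → Ideal (MvPolynomial V k)}
    (hK : ∀ v τ, ∀ f ∈ K (insert v τ), X v * f ∈ K τ)
    (hL : ∀ v τ, ∀ f ∈ L (insert v τ), X v * f ∈ L τ) {θ : MvPolynomial V k}
    (hθ : θ ∈ Submodule.span k (Set.range (X : V → MvPolynomial V k))) {i j : ℤ}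
    {f : Finset V → MvPolynomial V k}
    (hf : f ∈ relCocycles (scalarCoboundary V k) (polyCochains K)
      (polyCochains L) i j) :
    θ • f ∈ relCoboundaries (scalarCoboundary V k) (polyCochains K)
      (polyCochains L) i (j + 1) := by
  induction hθ using Submodule.span_induction with
  | mem θ hθ =>
    obtain ⟨v, rfl⟩ := hθ
    have h1 := polyCoboundary_contraction_add v ((X v : MvPolynomial V k) • f)
    rw [map_smul, map_smul, map_smul, map_smul, add_comm] at h1
    rw [← h1]
    refine Submodule.add_mem_sup ?_
      ⟨_, X_smul_contraction_mem (hK v) hf.1, (polyCoboundary V k).map_smul _ _⟩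
    have h2 := X_smul_contraction_mem (hL v) hf.2
    rwa [add_sub_cancel_right] at h2
  | zero =>
    rw [zero_smul]
    exact zero_mem _
  | add a b _ _ ha hb =>
    rw [add_smul]
    exact add_mem ha hb
  | smul c a _ ha =>
    rw [smul_assoc]
    exact Submodule.smul_mem _ c ha

end PartitionComplex

/-! ### Stars and the maps between their face ideals. -/

section StarIdeals

variable {V : Type*} [DecidableEq V] {k : Type*} [Field k]

theorem Complex.mem_star {Δ : Complex V} {τ ρ : Finset V} :
    ρ ∈ Δ.star τ ↔ τ ∪ ρ ∈ Δ :=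
  ⟨fun h => h.2, fun h => ⟨Δ.lower Finset.subset_union_right h, h⟩⟩

theorem Complex.star_empty (Δ : Complex V) : Δ.star ∅ = Δ :=
  SetLike.ext fun ρ => by rw [Complex.mem_star, Finset.empty_union]

theorem RelComplex.star_empty (Ψ : RelComplex V) : Ψ.star ∅ = Ψ := by
  cases Ψ
  simp [RelComplex.star, Complex.star_empty]

theorem RelComplex.mem_faces_star {Ψ : RelComplex V} {τ ρ : Finset V} :
    ρ ∈ (Ψ.star τ).faces ↔ τ ∪ ρ ∈ Ψ.faces :=
  and_congr Complex.mem_star (not_congr Complex.mem_star)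

/-- A facet `σ` of the star absorbs `τ`, because `τ ∪ σ` is again a face of the star. Hence purity
and the generic condition on facets pass to every star. -/
theorem RelComplex.maximal_faces_of_star {Ψ : RelComplex V} {τ σ : Finset V}
    (h : Maximal (· ∈ (Ψ.star τ).faces) σ) : Maximal (· ∈ Ψ.faces) σ := by
  have h1 : τ ∪ σ ∈ (Ψ.star τ).faces := by
    rw [RelComplex.mem_faces_star, ← Finset.union_assoc, Finset.union_self]
    exact RelComplex.mem_faces_star.1 h.1
  have h2 : τ ∪ σ = σ := le_antisymm (h.2 h1 Finset.subset_union_right) Finset.subset_union_right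
  have hτ : τ ⊆ σ := Finset.union_eq_right.1 h2
  refine ⟨h2 ▸ RelComplex.mem_faces_star.1 h.1, fun ρ hρ hle => h.2 ?_ hle⟩
  refine RelComplex.mem_faces_star.2 ?_
  rw [Finset.union_eq_right.2 (hτ.trans hle)]
  exact hρ

theorem nonfaceIdeal_star_le (Δ : Complex V) (τ : Finset V) (v : V) :
    nonfaceIdeal k (Δ.star τ) ≤ nonfaceIdeal k (Δ.star (insert v τ)) :=
  nonfaceIdeal_anti fun _ hρ => Complex.mem_star.2 <| Δ.lower
    (Finset.union_subset_union_left (Finset.subset_insert v τ)) (Complex.mem_star.1 hρ)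

/-- The factor `X v` puts `v` into every support, so adding `v` to `τ` changes nothing. This is what
makes `X v` times the contraction well defined. -/
theorem X_mul_mem_nonfaceIdeal_star {Δ : Complex V} {τ : Finset V} {v : V} {f : MvPolynomial V k}
    (hf : f ∈ nonfaceIdeal k (Δ.star (insert v τ))) : X v * f ∈ nonfaceIdeal k (Δ.star τ) := by
  refine mem_nonfaceIdeal.2 fun b hb hbΔ => ?_
  rw [support_X_mul, Finset.mem_map] at hb
  obtain ⟨a, ha, rfl⟩ := hb
  refine mem_nonfaceIdeal.1 hf a ha (Complex.mem_star.2 (Δ.lower ?_ (Complex.mem_star.1 hbΔ)))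
  intro w hw
  rw [Finset.mem_union, Finset.mem_insert] at hw
  rw [Finset.mem_union]
  obtain (rfl | hw) | hw := hw
  · right
    simp
  · exact Or.inl hw
  · right
    simp only [addLeftEmbedding_apply, Finsupp.mem_support_iff, Finsupp.add_apply] at hw ⊢
    omega

theorem relIdeal_star_le (Ψ : RelComplex V) (Θ : List (MvPolynomial V k)) (τ : Finset V) (v : V) :
    relIdeal k (Ψ.star τ) Θ ≤ relIdeal k (Ψ.star (insert v τ)) Θ :=
  sup_le_sup (nonfaceIdeal_star_le _ τ v) (Ideal.mul_mono_right (nonfaceIdeal_star_le _ τ v))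

theorem X_mul_mem_relIdeal_star {Ψ : RelComplex V} {Θ : List (MvPolynomial V k)} {τ : Finset V}
    {v : V} {f : MvPolynomial V k} (hf : f ∈ relIdeal k (Ψ.star (insert v τ)) Θ) :
    X v * f ∈ relIdeal k (Ψ.star τ) Θ := by
  have h1 : ∀ Δ : Complex V, Ideal.span {X v} * nonfaceIdeal k (Δ.star (insert v τ)) ≤
      nonfaceIdeal k (Δ.star τ) := fun Δ =>
    Ideal.span_singleton_mul_le_iff.2 fun f hf => X_mul_mem_nonfaceIdeal_star hf
  have h2 : Ideal.span {X v} * relIdeal k (Ψ.star (insert v τ)) Θ ≤ relIdeal k (Ψ.star τ) Θ := by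
    rw [relIdeal, Ideal.mul_sup, mul_left_comm]
    exact sup_le_sup (h1 _) (Ideal.mul_mono_right (h1 _))
  exact Ideal.span_singleton_mul_le_iff.1 h2 f hf

end StarIdeals

/-! ### The partition complex: parameter steps and acyclicity in positive degree. -/

section Steps

open Module

attribute [local instance] MvPolynomial.gradedAlgebra

variable {V : Type*} {k : Type*} [Field k]

/-- Multiplication of families of polynomials by `θ`. -/
def smulFamily (θ : MvPolynomial V k) :
    (Finset V → MvPolynomial V k) →ₗ[k] (Finset V → MvPolynomial V k) where
  toFun f := θ • f
  map_add' f g := smul_add θ f g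
  map_smul' c f := smul_comm θ c f

theorem smulFamily_mem_polyCochains {K : Finset V → Ideal (MvPolynomial V k)} {i j : ℤ}
    {θ : MvPolynomial V k} (hθ : θ.IsHomogeneous 1) {f : Finset V → MvPolynomial V k}
    (hf : f ∈ polyCochains K i j) : smulFamily θ f ∈ polyCochains K i (j + 1) :=
  smul_mem_polyCochains hf hθ fun τ => Ideal.mul_mem_left _ _ (hf τ).1.1

theorem mem_polyCochains_of_smulFamily_mem {K L : Finset V → Ideal (MvPolynomial V k)} {i j : ℤ}
    {θ : MvPolynomial V k} (h : ∀ τ : Finset V, (τ.card : ℤ) = i →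
      ∀ (d : ℕ) (f : MvPolynomial V k), f ∈ K τ → f.IsHomogeneous d → θ * f ∈ L τ → f ∈ L τ)
    {f : Finset V → MvPolynomial V k} (hf : f ∈ polyCochains K i j)
    (hθf : smulFamily θ f ∈ polyCochains L i (j + 1)) : f ∈ polyCochains L i j := by
  intro τ
  refine ⟨⟨?_, (hf τ).1.2⟩, (hf τ).2⟩
  by_cases hτ : (τ.card : ℤ) = i
  swap
  · rw [(hf τ).2 hτ]
    exact zero_mem _
  obtain hj | hj := lt_or_ge j 0
  · have := (hf τ).1
    rw [gradedPiece_of_neg _ hj, Submodule.mem_bot] at this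
    rw [this]
    exact zero_mem _
  lift j to ℕ using hj
  obtain ⟨h1, h2⟩ := mem_gradedPiece_natCast.1 (hf τ).1
  exact h τ hτ j _ h1 h2 (hθf τ).1.1

theorem polyCochains_sup_span_mul {K L : Finset V → Ideal (MvPolynomial V k)}
    (hK : ∀ τ, (K τ).IsHomogeneous (homogeneousSubmodule V k))
    (hL : ∀ τ, (L τ).IsHomogeneous (homogeneousSubmodule V k)) {θ : MvPolynomial V k}
    (hθ : θ.IsHomogeneous 1) (i j : ℤ) :
    polyCochains (fun τ => K τ ⊔ Ideal.span {θ} * L τ) i j =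
      polyCochains K i j ⊔ (polyCochains L i (j - 1)).map (smulFamily θ) := by
  classical
  refine le_antisymm ?_ (sup_le (polyCochains_mono (fun τ => le_sup_left) i j) ?_)
  · intro f hf
    have h1 : ∀ τ, ∃ a ∈ gradedPiece (K τ) j, ∃ b ∈ gradedPiece (L τ) (j - 1),
        a + θ * b = f τ := by
      intro τ
      have h2 := (hf τ).1
      rw [gradedPiece_sup_span_mul (hK τ) (hL τ) hθ] at h2
      obtain ⟨a, ha, _, ⟨b, hb, rfl⟩, hab⟩ := Submodule.mem_sup.1 h2
      exact ⟨a, ha, b, hb, hab⟩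
    choose a ha b hb hab using h1
    refine Submodule.mem_sup.2 ⟨fun τ => if (τ.card : ℤ) = i then a τ else 0, fun τ => ?_, _,
      ⟨fun τ => if (τ.card : ℤ) = i then b τ else 0, fun τ => ?_, rfl⟩, funext fun τ => ?_⟩
    · exact ⟨by dsimp only; split_ifs; exacts [ha τ, zero_mem _], fun h => if_neg h⟩
    · exact ⟨by dsimp only; split_ifs; exacts [hb τ, zero_mem _], fun h => if_neg h⟩
    · change (if (τ.card : ℤ) = i then a τ else 0) +
        θ * (if (τ.card : ℤ) = i then b τ else 0) = f τ
      split_ifs with h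
      · exact hab τ
      · rw [(hf τ).2 h, mul_zero, add_zero]
  · rintro _ ⟨g, hg, rfl⟩
    have := smul_mem_polyCochains (L := fun τ => K τ ⊔ Ideal.span {θ} * L τ) hg hθ fun τ =>
      Submodule.mem_sup_right (Ideal.mul_mem_mul (Ideal.mem_span_singleton_self θ) (hg τ).1.1)
    rwa [sub_add_cancel] at this

theorem isHomogeneous_one_of_mem_span_X {θ : MvPolynomial V k}
    (hθ : θ ∈ Submodule.span k (Set.range (X : V → MvPolynomial V k))) : θ.IsHomogeneous 1 := by
  have : Submodule.span k (Set.range (X : V → MvPolynomial V k)) ≤ homogeneousSubmodule V k 1 := by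
    rw [Submodule.span_le]
    rintro _ ⟨v, rfl⟩
    exact isHomogeneous_X k v
  exact this hθ

variable (k) in
/-- The part of a family of polynomials that consists of the multiples of one monomial. -/
def monomialPart (a : V →₀ ℕ) :
    (Finset V → MvPolynomial V k) →ₗ[k] (Finset V → MvPolynomial V k) :=
  ((monomial a).comp (lcoeff k a)).compLeft (Finset V)

theorem monomialPart_apply (a : V →₀ ℕ) (f : Finset V → MvPolynomial V k) (τ : Finset V) :
    monomialPart k a f τ = monomial a (coeff a (f τ)) := rfl

variable [LinearOrder V]

/-- Regularity is required only for nonempty `τ`, since injectivity is asked only in positions `i ≥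
1`; the Buchsbaum condition controls exactly these stars. -/
theorem isParameterStep_polyCochains [Finite V] (Ψ : RelComplex V) (Θ : List (MvPolynomial V k))
    {θ : MvPolynomial V k} (hθ : θ ∈ Submodule.span k (Set.range (X : V → MvPolynomial V k)))
    (hreg : ∀ τ : Finset V, τ.Nonempty → ∀ (d : ℕ) (f : MvPolynomial V k),
      f ∈ nonfaceIdeal k (Ψ.Γ.star τ) → f.IsHomogeneous d → θ * f ∈ relIdeal k (Ψ.star τ) Θ →
      f ∈ relIdeal k (Ψ.star τ) Θ) :
    IsParameterStep (scalarCoboundary V k) (smulFamily θ)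
      (polyCochains fun τ => nonfaceIdeal k (Ψ.Γ.star τ))
      (polyCochains fun τ => relIdeal k (Ψ.star τ) Θ) where
  finite := finiteDimensional_polyCochains _
  le := polyCochains_mono fun τ => relIdeal_le (Ψ.star τ) Θ
  d_mem_X _ _ _ := polyCoboundary_mem (nonfaceIdeal_star_le Ψ.Γ)
  d_mem_N _ _ _ := polyCoboundary_mem (relIdeal_star_le Ψ Θ)
  smul_mem_N _ _ _ := smulFamily_mem_polyCochains (isHomogeneous_one_of_mem_span_X hθ)
  d_d := polyCoboundary_polyCoboundary
  comm := (polyCoboundary V k).map_smul θ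
  injective i j hi x := mem_polyCochains_of_smulFamily_mem fun τ hτ =>
    hreg τ (Finset.card_pos.1 (by omega))
  kills _ _ _ _ := smul_mem_relCoboundaries (fun _ _ _ => X_mul_mem_nonfaceIdeal_star)
    (fun _ _ _ => X_mul_mem_relIdeal_star) hθ

theorem polyCochains_relIdeal_concat (Ψ : RelComplex V) (Θ : List (MvPolynomial V k))
    (hΘ : ∀ θ ∈ Θ, ∃ e, θ.IsHomogeneous e) {θ : MvPolynomial V k} (hθ : θ.IsHomogeneous 1)
    (i j : ℤ) :
    polyCochains (fun τ => relIdeal k (Ψ.star τ) (Θ ++ [θ])) i j =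
      polyCochains (fun τ => relIdeal k (Ψ.star τ) Θ) i j ⊔
        (polyCochains (fun τ => nonfaceIdeal k (Ψ.Γ.star τ)) i (j - 1)).map
          (smulFamily θ) := by
  rw [← polyCochains_sup_span_mul (fun τ => relIdeal_isHomogeneous (Ψ.star τ) Θ hΘ)
    (fun τ => nonfaceIdeal_isHomogeneous _) hθ]
  congr 1
  funext τ
  exact relIdeal_concat _ _ _

theorem polyCoboundary_monomialPart (a : V →₀ ℕ) (f : Finset V → MvPolynomial V k) :
    polyCoboundary V k (monomialPart k a f) = monomialPart k a (polyCoboundary V k f) := by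
  funext τ
  rw [monomialPart_apply, polyCoboundary_apply, polyCoboundary_apply, coeff_sum, map_sum]
  refine Finset.sum_congr rfl fun v _ => ?_
  rw [coeff_smul, ← smul_monomial, monomialPart_apply]

theorem monomialPart_mem {Δ : Complex V} {a : V →₀ ℕ} {i j : ℤ} {f : Finset V → MvPolynomial V k}
    (hf : f ∈ polyCochains (fun τ => nonfaceIdeal k (Δ.star τ)) i j) :
    monomialPart k a f ∈ polyCochains (fun τ => nonfaceIdeal k (Δ.star τ)) i j := by
  classical
  intro τ
  rw [monomialPart_apply]
  have hsub : ∀ b ∈ (monomial a (coeff a (f τ))).support, b ∈ (f τ).support := by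
    intro b hb
    rw [support_monomial] at hb
    split_ifs at hb with h
    · exact absurd hb (Finset.notMem_empty b)
    · rw [Finset.mem_singleton.1 hb, MvPolynomial.mem_support_iff]
      exact h
  refine ⟨⟨mem_nonfaceIdeal.2 fun b hb => mem_nonfaceIdeal.1 (hf τ).1.1 b (hsub b hb),
    fun b hb => (hf τ).1.2 (hsub b hb)⟩, fun h => ?_⟩
  rw [(hf τ).2 h, coeff_zero, monomial_zero]

/-- When `v` is in the support of `a`, the monomial `a` cannot distinguish the stars of `τ` and
`insert v τ`, so contraction needs no factor `X v`. -/
theorem contraction_monomialPart_mem {Δ : Complex V} {a : V →₀ ℕ} {v : V} (hv : v ∈ a.support)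
    {i j : ℤ} {f : Finset V → MvPolynomial V k}
    (hf : f ∈ polyCochains (fun τ => nonfaceIdeal k (Δ.star τ)) i j) :
    contraction k v (monomialPart k a f) ∈
      polyCochains (fun τ => nonfaceIdeal k (Δ.star τ)) (i - 1) j := by
  classical
  refine contraction_mem (monomialPart_mem hf) fun τ => ?_
  have h1 := ((monomialPart_mem (a := a) hf) (insert v τ)).1.1
  rw [monomialPart_apply] at h1 ⊢
  refine mem_nonfaceIdeal.2 fun b hb hbΔ => mem_nonfaceIdeal.1 h1 b hb ?_
  have hba : b = a := Finset.mem_singleton.1 (support_monomial_subset hb)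
  rw [Complex.mem_star] at hbΔ ⊢
  rwa [Finset.insert_union, Finset.insert_eq_of_mem]
  rw [hba]
  exact Finset.mem_union_right _ hv

/-- The partition complex has no cohomology in positive internal degree. -/
theorem relBetti_nonfaceIdeal_of_pos [Finite V] (Ψ : RelComplex V) (i : ℤ) {j : ℤ} (hj : 0 < j) :
    relBetti (scalarCoboundary V k)
      (polyCochains fun τ => nonfaceIdeal k (Ψ.Γ.star τ))
      (polyCochains fun τ => nonfaceIdeal k (Ψ.Δ.star τ)) i j = 0 := by
  suffices key : relCocycles (scalarCoboundary V k)
      (polyCochains fun τ => nonfaceIdeal k (Ψ.Γ.star τ))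
      (polyCochains fun τ => nonfaceIdeal k (Ψ.Δ.star τ)) i j =
      relCoboundaries (scalarCoboundary V k)
      (polyCochains fun τ => nonfaceIdeal k (Ψ.Γ.star τ))
      (polyCochains fun τ => nonfaceIdeal k (Ψ.Δ.star τ)) i j by
    rw [relBetti, key, sub_self]
  refine le_antisymm ?_ (sup_le ?_ ?_)
  · rintro f ⟨hf, hdf⟩
    have hfin : {a : V →₀ ℕ | (a.degree : ℤ) = j}.Finite := by
      refine (Finsupp.finite_of_degree_eq (σ := V) j.toNat).subset ?_
      intro a ha
      have : (a.degree : ℤ) = j := ha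
      change a.degree = j.toNat
      omega
    have hsum : f = ∑ a ∈ hfin.toFinset, monomialPart k a f := by
      funext τ
      rw [Finset.sum_apply]
      simp only [monomialPart_apply]
      conv_lhs => rw [as_sum (f τ)]
      refine Finset.sum_subset (fun a ha => hfin.mem_toFinset.2 ((hf τ).1.2 ha)) fun a _ ha => ?_
      rw [notMem_support_iff.1 ha, monomial_zero]
    rw [hsum]
    refine sum_mem fun a ha => ?_
    have hdeg : (a.degree : ℤ) = j := hfin.mem_toFinset.1 ha
    -- Positive degree is used here: each fine-graded piece has a variable to contract with.
    obtain ⟨v, hv⟩ : a.support.Nonempty := by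
      rw [Finset.nonempty_iff_ne_empty]
      intro h
      rw [Finsupp.support_eq_empty] at h
      rw [h, map_zero] at hdeg
      simp at hdeg
      omega
    rw [← polyCoboundary_contraction_add v (monomialPart k a f), add_comm,
      polyCoboundary_monomialPart]
    have h1 := contraction_monomialPart_mem (a := a) hv hdf
    rw [add_sub_cancel_right] at h1
    exact Submodule.add_mem_sup h1 ⟨_, contraction_monomialPart_mem hv hf, rfl⟩
  · exact fun f hf => ⟨polyCochains_mono (fun τ => nonfaceIdeal_anti (Ψ.star τ).le) i j hf,
      polyCoboundary_mem (nonfaceIdeal_star_le Ψ.Δ) hf⟩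
  · rintro _ ⟨f, hf, rfl⟩
    have h1 := polyCoboundary_mem (nonfaceIdeal_star_le Ψ.Γ) hf
    rw [sub_add_cancel] at h1
    refine ⟨h1, ?_⟩
    have h2 : scalarCoboundary V k (scalarCoboundary V k f) = 0 := polyCoboundary_polyCoboundary f
    rw [Submodule.comap_coe, Set.mem_preimage, h2]
    exact zero_mem _

end Steps

/-! ### Polynomial degree zero and simplicial cohomology. -/

section DegreeZero

open Module

variable {V : Type*} {k : Type*} [Field k]

/-- All preimages share the same kernel part, so differences of dimensions can be computed in `F`.
-/
theorem finrank_inf_comap_of_map_eq_top {E F : Type*} [AddCommGroup E] [Module k E]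
    [AddCommGroup F] [Module k F] [FiniteDimensional k F] (f : E →ₗ[k] F) (X : Submodule k E)
    [FiniteDimensional k X] (hf : X.map f = ⊤) (U : Submodule k F) :
    finrank k ↥(X ⊓ U.comap f) = finrank k ↥(X ⊓ LinearMap.ker f) + finrank k U := by
  have : FiniteDimensional k ↥(X ⊓ U.comap f) := Submodule.finiteDimensional_of_le inf_le_left
  have h1 := finrank_sup_map_add_finrank_inf_comap f (X ⊓ U.comap f) ⊥
  have h2 : (X ⊓ U.comap f).map f = U := by
    refine le_antisymm ?_ fun u hu => ?_
    · rintro _ ⟨x, hx, rfl⟩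
      exact hx.2
    · obtain ⟨x, hx, rfl⟩ : u ∈ X.map f := hf ▸ Submodule.mem_top
      exact ⟨x, ⟨hx, hu⟩, rfl⟩
  have h3 : X ⊓ U.comap f ⊓ Submodule.comap f ⊥ = X ⊓ LinearMap.ker f := by
    rw [inf_assoc, ← Submodule.comap_inf, inf_bot_eq]
    rfl
  rw [bot_sup_eq, h2, h3, finrank_bot] at h1
  omega

variable (k) in
/-- The cochain formed by the constant terms of a family of polynomials. -/
def constantCochain (Ψ : RelComplex V) (m : ℕ) :
    (Finset V → MvPolynomial V k) →ₗ[k] Cochain k Ψ m where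
  toFun f σ := coeff 0 (f σ.1)
  map_add' f g := funext fun σ => coeff_add 0 (f σ.1) (g σ.1)
  map_smul' c f := funext fun σ => coeff_smul 0 c (f σ.1)

theorem constantCochain_apply (Ψ : RelComplex V) (m : ℕ) (f : Finset V → MvPolynomial V k)
    (σ : {σ : Finset V // σ ∈ Ψ.faces ∧ σ.card = m}) :
    constantCochain k Ψ m f σ = coeff 0 (f σ.1) := rfl

variable [LinearOrder V]

/-- A nonzero constant lies in the nonface ideal of the star of `τ` exactly when that star is void,
that is, when `τ` is not a face. -/
theorem mem_polyCochains_nonfaceIdeal_zero {Δ : Complex V} {i : ℤ}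
    {f : Finset V → MvPolynomial V k} :
    f ∈ polyCochains (fun τ => nonfaceIdeal k (Δ.star τ)) i 0 ↔
      ∀ τ, f τ = C (coeff 0 (f τ)) ∧ (coeff 0 (f τ) ≠ 0 → τ ∉ Δ ∧ (τ.card : ℤ) = i) := by
  have hmem : ∀ τ : Finset V, ∅ ∈ Δ.star τ ↔ τ ∈ Δ := fun τ => by
    rw [Complex.mem_star, Finset.union_empty]
  refine forall_congr' fun τ => ⟨fun ⟨⟨h1, h2⟩, h3⟩ => ⟨?_, fun h => ⟨?_, ?_⟩⟩,
    fun ⟨h1, h2⟩ => ⟨⟨mem_nonfaceIdeal.2 ?_, ?_⟩, fun h => ?_⟩⟩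
  · ext a
    rw [coeff_C]
    split_ifs with ha
    · rw [← ha]
    · by_contra h
      have h4 : (a.degree : ℤ) = 0 := h2 (MvPolynomial.mem_support_iff.2 h)
      exact ha ((Finsupp.degree_eq_zero_iff a).1 (by exact_mod_cast h4)).symm
  · rw [← hmem]
    have := mem_nonfaceIdeal.1 h1 0 (MvPolynomial.mem_support_iff.2 h)
    rwa [Finsupp.support_zero] at this
  · by_contra h4
    exact h (by rw [h3 h4, coeff_zero])
  all_goals by_cases h0 : coeff 0 (f τ) = 0
  · rw [h1, h0, map_zero]
    simp
  · intro a ha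
    rw [h1] at ha
    rw [Finset.mem_singleton.1 (support_monomial_subset ha), Finsupp.support_zero, hmem]
    exact (h2 h0).1
  · rw [h1, h0, map_zero]
    exact zero_mem _
  · intro a ha
    rw [Finset.mem_coe, h1] at ha
    rw [Finset.mem_singleton.1 (support_monomial_subset ha)]
    simp
  · rw [h1, h0, map_zero]
  · exact absurd (h2 h0).2 h

theorem inf_ker_constantCochain (Ψ : RelComplex V) (m : ℕ) :
    polyCochains (fun τ => nonfaceIdeal k (Ψ.Γ.star τ)) m 0 ⊓
        LinearMap.ker (constantCochain k Ψ m) =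
      polyCochains (fun τ => nonfaceIdeal k (Ψ.Δ.star τ)) m 0 := by
  ext f
  rw [Submodule.mem_inf, mem_polyCochains_nonfaceIdeal_zero, mem_polyCochains_nonfaceIdeal_zero,
    LinearMap.mem_ker]
  refine ⟨fun ⟨h1, h2⟩ τ => ⟨(h1 τ).1, fun h => ⟨fun hτ => h ?_, ((h1 τ).2 h).2⟩⟩,
    fun h1 => ⟨fun τ => ⟨(h1 τ).1, fun h => ⟨fun hτ => ((h1 τ).2 h).1 (Ψ.le hτ), ((h1 τ).2 h).2⟩⟩,
      funext fun σ => ?_⟩⟩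
  · exact congrFun h2 ⟨τ, ⟨hτ, ((h1 τ).2 h).1⟩, by exact_mod_cast ((h1 τ).2 h).2⟩
  · by_contra h
    exact ((h1 σ.1).2 h).1 σ.2.1.1

theorem exists_constantCochain_eq (Ψ : RelComplex V) (m : ℕ) (g : Cochain k Ψ m) :
    ∃ f ∈ polyCochains (fun τ => nonfaceIdeal k (Ψ.Γ.star τ)) m 0, constantCochain k Ψ m f = g := by
  classical
  refine ⟨fun τ => C (g.val τ), mem_polyCochains_nonfaceIdeal_zero.2 fun τ => ?_,
    funext fun σ => ?_⟩
  · rw [coeff_zero_C, Cochain.val]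
    refine ⟨rfl, fun h => ?_⟩
    split_ifs at h with h1
    · exact ⟨h1.1.2, by exact_mod_cast h1.2⟩
    · exact absurd rfl h
  · rw [constantCochain_apply, coeff_zero_C, Cochain.val, dif_pos σ.2]

theorem map_constantCochain (Ψ : RelComplex V) (m : ℕ) :
    (polyCochains (fun τ => nonfaceIdeal k (Ψ.Γ.star τ)) m 0).map (constantCochain k Ψ m) = ⊤ :=
  Submodule.eq_top_iff'.2 fun g => exists_constantCochain_eq Ψ m g

theorem constantCochain_scalarCoboundary (Ψ : RelComplex V) (m : ℕ)
    {f : Finset V → MvPolynomial V k}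
    (hf : f ∈ polyCochains (fun τ => nonfaceIdeal k (Ψ.Γ.star τ)) m 0) :
    constantCochain k Ψ (m + 1) (scalarCoboundary V k f) =
      coboundary k Ψ m (constantCochain k Ψ m f) := by
  funext τ
  rw [constantCochain_apply, scalarCoboundary_apply, polyCoboundary_apply, coeff_sum]
  refine Finset.sum_congr rfl fun v hv => ?_
  rw [coeff_smul, smul_eq_mul, Cochain.val]
  split_ifs with h
  · rfl
  · congr 1
    -- `τ \ {v}` lies in `Δ`, so it can fail to be a face of `Ψ` only by lying in `Γ`, where
    -- degree-zero members of the complex vanish.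
    by_contra h0
    refine h ⟨⟨Ψ.Δ.lower (Finset.erase_subset v τ.1) τ.2.1.1,
      ((mem_polyCochains_nonfaceIdeal_zero.1 hf _).2 h0).1⟩, ?_⟩
    rw [Finset.card_erase_of_mem hv, τ.2.2, Nat.add_sub_cancel]

theorem relCocycles_nonfaceIdeal (Ψ : RelComplex V) (m : ℕ) :
    relCocycles (scalarCoboundary V k) (polyCochains fun τ => nonfaceIdeal k (Ψ.Γ.star τ))
        (polyCochains fun τ => nonfaceIdeal k (Ψ.Δ.star τ)) m 0 =
      polyCochains (fun τ => nonfaceIdeal k (Ψ.Γ.star τ)) m 0 ⊓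
        (LinearMap.ker (coboundary k Ψ m)).comap (constantCochain k Ψ m) := by
  ext f
  refine and_congr_right fun hf => ?_
  rw [Submodule.comap_coe, Submodule.comap_coe, Set.mem_preimage, Set.mem_preimage, SetLike.mem_coe,
    SetLike.mem_coe, LinearMap.mem_ker, ← constantCochain_scalarCoboundary Ψ m hf,
    ← Nat.cast_add_one, ← inf_ker_constantCochain, Submodule.mem_inf, LinearMap.mem_ker]
  refine and_iff_right ?_
  rw [Nat.cast_add_one]
  exact polyCoboundary_mem (nonfaceIdeal_star_le Ψ.Γ) hf

theorem relCoboundaries_nonfaceIdeal (Ψ : RelComplex V) (m : ℕ) :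
    relCoboundaries (scalarCoboundary V k) (polyCochains fun τ => nonfaceIdeal k (Ψ.Γ.star τ))
        (polyCochains fun τ => nonfaceIdeal k (Ψ.Δ.star τ)) (m + 1 : ℕ) 0 =
      polyCochains (fun τ => nonfaceIdeal k (Ψ.Γ.star τ)) (m + 1 : ℕ) 0 ⊓
        (LinearMap.range (coboundary k Ψ m)).comap (constantCochain k Ψ (m + 1)) := by
  have hcast : ((m + 1 : ℕ) : ℤ) - 1 = m := by push_cast; ring
  have hX : ∀ g ∈ polyCochains (fun τ => nonfaceIdeal k (Ψ.Γ.star τ)) m 0,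
      scalarCoboundary V k g ∈
        polyCochains (fun τ => nonfaceIdeal k (Ψ.Γ.star τ)) (m + 1 : ℕ) 0 := fun g hg => by
    rw [Nat.cast_add_one]
    exact polyCoboundary_mem (nonfaceIdeal_star_le Ψ.Γ) hg
  rw [relCoboundaries, hcast, ← inf_ker_constantCochain]
  refine le_antisymm (sup_le ?_ ?_) ?_
  · rintro f ⟨h1, h2⟩
    exact ⟨h1, 0, by rw [map_zero, LinearMap.mem_ker.1 h2]⟩
  · rintro _ ⟨g, hg, rfl⟩
    exact ⟨hX g hg, _, (constantCochain_scalarCoboundary Ψ m hg).symm⟩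
  · rintro f ⟨h1, u, hu⟩
    obtain ⟨g, hg, rfl⟩ := exists_constantCochain_eq Ψ m u
    rw [← sub_add_cancel f (scalarCoboundary V k g)]
    refine Submodule.add_mem_sup ⟨sub_mem h1 (hX g hg), ?_⟩ ⟨g, hg, rfl⟩
    rw [SetLike.mem_coe, LinearMap.mem_ker, map_sub, constantCochain_scalarCoboundary Ψ m hg, hu,
      sub_self]

/-- In internal degree zero the partition complex computes the cohomology of the pair. -/
theorem relBetti_nonfaceIdeal_zero [Finite V] (Ψ : RelComplex V) (i : ℕ) :
    relBetti (scalarCoboundary V k) (polyCochains fun τ => nonfaceIdeal k (Ψ.Γ.star τ))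
      (polyCochains fun τ => nonfaceIdeal k (Ψ.Δ.star τ)) (i + 1 : ℕ) 0 =
      finrank k (cohomology k Ψ i) := by
  have : FiniteDimensional k (polyCochains (fun τ => nonfaceIdeal k (Ψ.Γ.star τ)) (i + 1 : ℕ) 0) :=
    finiteDimensional_polyCochains _ _ _
  have hle : LinearMap.range (coboundary k Ψ i) ≤ LinearMap.ker (coboundary k Ψ (i + 1)) := by
    rintro _ ⟨u, rfl⟩
    obtain ⟨g, hg, rfl⟩ := exists_constantCochain_eq Ψ i u
    have h1 : scalarCoboundary V k g ∈
        polyCochains (fun τ => nonfaceIdeal k (Ψ.Γ.star τ)) (i + 1 : ℕ) 0 := by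
      rw [Nat.cast_add_one]
      exact polyCoboundary_mem (nonfaceIdeal_star_le Ψ.Γ) hg
    rw [LinearMap.mem_ker, ← constantCochain_scalarCoboundary Ψ i hg,
      ← constantCochain_scalarCoboundary Ψ (i + 1) h1]
    have h2 : scalarCoboundary V k (scalarCoboundary V k g) = 0 := polyCoboundary_polyCoboundary g
    rw [h2, map_zero]
  have h1 := Submodule.finrank_quotient_add_finrank
    ((LinearMap.range (coboundary k Ψ i)).submoduleOf (LinearMap.ker (coboundary k Ψ (i + 1))))
  rw [(Submodule.submoduleOfEquivOfLe hle).finrank_eq] at h1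
  -- Position `i + 1` carries the sets with `i + 1` elements, the faces of dimension `i`. The common
  -- kernel part of cocycles and coboundaries cancels.
  rw [relBetti, relCocycles_nonfaceIdeal, relCoboundaries_nonfaceIdeal,
    finrank_inf_comap_of_map_eq_top _ _ (map_constantCochain Ψ (i + 1)),
    finrank_inf_comap_of_map_eq_top _ _ (map_constantCochain Ψ (i + 1)), ← h1]
  push_cast
  ring

/-- This is the vanishing of `H^{-1}`: the coboundary at `{v}` is, up to sign, the value at `∅`, and
since `{v}` is a face of `Δ` a cocycle must vanish there. -/
theorem relBetti_nonfaceIdeal_zero_zero (Ψ : RelComplex V) {v : V}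
    (hv : ({v} : Finset V) ∈ Ψ.Δ) :
    relBetti (scalarCoboundary V k) (polyCochains fun τ => nonfaceIdeal k (Ψ.Γ.star τ))
      (polyCochains fun τ => nonfaceIdeal k (Ψ.Δ.star τ)) 0 0 = 0 := by
  suffices key : relCocycles (scalarCoboundary V k)
      (polyCochains fun τ => nonfaceIdeal k (Ψ.Γ.star τ))
      (polyCochains fun τ => nonfaceIdeal k (Ψ.Δ.star τ)) 0 0 =
      relCoboundaries (scalarCoboundary V k)
      (polyCochains fun τ => nonfaceIdeal k (Ψ.Γ.star τ))
      (polyCochains fun τ => nonfaceIdeal k (Ψ.Δ.star τ)) 0 0 by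
    rw [relBetti, key, sub_self]
  rw [relCoboundaries, polyCochains_of_neg_left _ (i := 0 - 1) (by norm_num), Submodule.map_bot,
    sup_bot_eq]
  refine le_antisymm ?_ fun f hf =>
    ⟨polyCochains_mono (fun τ => nonfaceIdeal_anti (Ψ.star τ).le) 0 0 hf,
      polyCoboundary_mem (nonfaceIdeal_star_le Ψ.Δ) hf⟩
  rintro f ⟨hf, hdf⟩
  refine mem_polyCochains_nonfaceIdeal_zero.2 fun τ =>
    ⟨(mem_polyCochains_nonfaceIdeal_zero.1 hf τ).1, fun h => ?_⟩
  have hcard := ((mem_polyCochains_nonfaceIdeal_zero.1 hf τ).2 h).2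
  have hτ : τ = ∅ := Finset.card_eq_zero.1 (by exact_mod_cast hcard)
  subst hτ
  refine absurd hv ((mem_polyCochains_nonfaceIdeal_zero.1 hdf {v}).2 ?_).1
  rw [scalarCoboundary_apply, polyCoboundary_apply, Finset.sum_singleton, Finset.erase_singleton,
    coeff_smul, smul_eq_mul]
  refine mul_ne_zero (fun h0 => ?_) h
  have := faceSign_mul_self (k := k) {v} v
  rw [h0, zero_mul] at this
  exact zero_ne_one this

end DegreeZero

/-! ### Hilbert functions of the quotients. -/

section Hilbert

open Module

attribute [local instance] MvPolynomial.gradedAlgebra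

variable {V : Type*} {k : Type*} [Field k]

/-- The only set with no elements is `∅`, whose star is everything: position 0 is the face module
itself. -/
theorem finrank_polyCochains_zero (K : Finset V → Ideal (MvPolynomial V k)) (j : ℤ) :
    finrank k (polyCochains K 0 j) = finrank k (gradedPiece (K ∅) j) := by
  classical
  let φ : polyCochains K 0 j →ₗ[k] gradedPiece (K ∅) j :=
    ((LinearMap.proj ∅).domRestrict (polyCochains K 0 j)).codRestrict _ fun f => (f.2 ∅).1
  refine (LinearEquiv.ofBijective φ ⟨?_, fun g => ⟨⟨Pi.single ∅ g.1, fun τ => ?_⟩, ?_⟩⟩).finrank_eq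
  · refine LinearMap.ker_eq_bot.1 ((Submodule.eq_bot_iff _).2 fun f hf => Subtype.ext (funext
      fun τ => ?_))
    by_cases hτ : τ = ∅
    · rw [hτ]
      exact congrArg Subtype.val (LinearMap.mem_ker.1 hf)
    · exact (f.2 τ).2 (by simpa using hτ)
  · by_cases hτ : τ = ∅
    · subst hτ
      rw [Pi.single_eq_same]
      exact ⟨g.2, fun h => absurd rfl h⟩
    · rw [Pi.single_eq_of_ne hτ]
      exact ⟨zero_mem _, fun _ => rfl⟩
  · refine Subtype.ext ?_
    change (Pi.single ∅ g.1 : Finset V → MvPolynomial V k) ∅ = g.1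
    exact Pi.single_eq_same _ _

theorem finrank_gradedPiece_nonfaceIdeal (Δ : Complex V) (j : ℕ) :
    finrank k (gradedPiece (nonfaceIdeal k Δ) j) =
      {a : V →₀ ℕ | a.degree = j ∧ a.support ∉ Δ}.ncard := by
  have h : gradedPiece (nonfaceIdeal k Δ) j =
      restrictSupport k {a : V →₀ ℕ | a.degree = j ∧ a.support ∉ Δ} := by
    ext f
    rw [mem_gradedPiece, mem_nonfaceIdeal, mem_restrictSupport_iff]
    refine ⟨fun h a ha => ⟨by exact_mod_cast h.2 a ha, h.1 a ha⟩, fun h => ⟨fun a ha => (h ha).2,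
      fun a ha => by exact_mod_cast (h ha).1⟩⟩
  rw [h, finrank_eq_nat_card_basis (basisRestrictSupport k _), Nat.card_coe_set_eq]

theorem finite_setOf_degree_eq [Finite V] (j : ℕ) (P : (V →₀ ℕ) → Prop) :
    {a : V →₀ ℕ | a.degree = j ∧ P a}.Finite :=
  (Finsupp.finite_of_degree_eq (σ := V) j).subset fun _ h => h.1

theorem finrank_gradedPiece_sub [Finite V] (Ψ : RelComplex V) (j : ℕ) :
    (finrank k (gradedPiece (nonfaceIdeal k Ψ.Γ) j) : ℤ) -
        finrank k (gradedPiece (nonfaceIdeal k Ψ.Δ) j) =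
      {a : V →₀ ℕ | a.degree = j ∧ a.support ∈ Ψ.faces}.ncard := by
  have h := Set.ncard_union_eq (s := {a : V →₀ ℕ | a.degree = j ∧ a.support ∈ Ψ.faces})
    (t := {a : V →₀ ℕ | a.degree = j ∧ a.support ∉ Ψ.Δ})
    (Set.disjoint_left.2 fun a h1 h2 => h2.2 h1.2.1) (finite_setOf_degree_eq _ _)
    (finite_setOf_degree_eq _ _)
  have h2 : {a : V →₀ ℕ | a.degree = j ∧ a.support ∈ Ψ.faces} ∪
      {a : V →₀ ℕ | a.degree = j ∧ a.support ∉ Ψ.Δ} =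
      {a : V →₀ ℕ | a.degree = j ∧ a.support ∉ Ψ.Γ} := by
    ext a
    have h3 := @Ψ.le a.support
    change (_ ∧ (_ ∧ _)) ∨ (_ ∧ _) ↔ _ ∧ _
    have h4 : a.support ∈ Ψ.Γ → a.support ∈ Ψ.Δ := h3
    tauto
  rw [finrank_gradedPiece_nonfaceIdeal, finrank_gradedPiece_nonfaceIdeal, ← h2, h]
  push_cast
  ring

theorem finrank_reducedDeg_add [Finite V] (Ψ : RelComplex V) (Θ : List (MvPolynomial V k))
    (j : ℕ) :
    finrank k (reducedDeg Ψ Θ j) + finrank k (gradedPiece (relIdeal k Ψ Θ) j) =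
      finrank k (gradedPiece (nonfaceIdeal k Ψ.Γ) j) := by
  let ι : nonfaceIdeal k Ψ.Γ →ₗ[k] MvPolynomial V k :=
    (nonfaceIdeal k Ψ.Γ).subtype.restrictScalars k
  have hι : Function.Injective ι := Subtype.val_injective
  let S : Submodule k (nonfaceIdeal k Ψ.Γ) := (homogeneousSubmodule V k j).comap ι
  let φ : nonfaceIdeal k Ψ.Γ →ₗ[k] QuotientBy (FaceModule k Ψ) Θ :=
    ((Ideal.ofList Θ • ⊤ :
      Submodule (MvPolynomial V k) (FaceModule k Ψ)).mkQ.restrictScalars k).comp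
      (((nonfaceIdeal k Ψ.Δ).submoduleOf (nonfaceIdeal k Ψ.Γ)).mkQ.restrictScalars k)
  have h1 : reducedDeg Ψ Θ j = S.map φ := (Submodule.map_comp _ _ _).symm
  have h2 : S.map ι = gradedPiece (nonfaceIdeal k Ψ.Γ) j := by
    ext f
    rw [mem_gradedPiece_natCast]
    refine ⟨?_, fun ⟨h, h'⟩ => ⟨⟨f, h⟩, h', rfl⟩⟩
    rintro ⟨g, hg, rfl⟩
    exact ⟨g.2, hg⟩
  have h3 : (S ⊓ Submodule.comap φ ⊥).map ι = gradedPiece (relIdeal k Ψ Θ) j := by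
    have h4 : ∀ f : nonfaceIdeal k Ψ.Γ, φ f = 0 ↔ (f : MvPolynomial V k) ∈ relIdeal k Ψ Θ :=
      fun f => (Submodule.Quotient.mk_eq_zero _).trans (mkQ_mem_ofList_smul_top Ψ Θ f)
    ext f
    rw [mem_gradedPiece_natCast]
    refine ⟨?_, fun ⟨h, h'⟩ => ⟨⟨f, relIdeal_le Ψ Θ h⟩, ⟨h', (h4 _).2 h⟩, rfl⟩⟩
    rintro ⟨g, hg, rfl⟩
    exact ⟨(h4 g).1 hg.2, hg.1⟩
  have e2 := (Submodule.equivMapOfInjective ι hι S).finrank_eq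
  have e3 := (Submodule.equivMapOfInjective ι hι (S ⊓ Submodule.comap φ ⊥)).finrank_eq
  have : FiniteDimensional k (S.map ι) := h2 ▸ inferInstance
  have : FiniteDimensional k S :=
    Module.Finite.equiv (Submodule.equivMapOfInjective ι hι S).symm
  have h5 := finrank_sup_map_add_finrank_inf_comap φ S ⊥
  rw [bot_sup_eq, finrank_bot, zero_add, ← h1, e2, e3, h2, h3] at h5
  exact h5

end Hilbert

/-! ### The Hilbert series and the `h`-vector. -/

section HVector

variable {V : Type*} [Fintype V]

open Classical in
theorem RelComplex.hPoly_eq_sum (Ψ : RelComplex V) {n : ℕ} (h : ∀ σ ∈ Ψ.faces, σ.card ≤ n) :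
    Ψ.hPoly n =
      ∑ σ with σ ∈ Ψ.faces, Polynomial.X ^ σ.card * (1 - Polynomial.X) ^ (n - σ.card) := by
  rw [← Finset.sum_fiberwise_of_maps_to (g := Finset.card) (t := Finset.range (n + 1))
    fun σ hσ => Finset.mem_range_succ_iff.2 (h σ (Finset.mem_filter.1 hσ).2)]
  refine Finset.sum_congr rfl fun m _ => ?_
  rw [Finset.sum_congr rfl fun σ hσ => by rw [(Finset.mem_filter.1 hσ).2], Finset.sum_const,
    nsmul_eq_mul, mul_assoc, Finset.filter_filter, fNum, Set.ncard_eq_toFinset_card']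
  congr 3
  ext σ
  simp

open Classical in
-- Each variable in `σ` has exponent at least 1 and contributes `x + x² + ⋯`; the others contribute
-- 1.
theorem coeff_prod_support (σ : Finset V) (j : ℕ) :
    PowerSeries.coeff j (∏ v, if v ∈ σ then
      (PowerSeries.mk fun i => if i = 0 then (0 : ℤ) else 1) else 1) =
      {a : V →₀ ℕ | a.degree = j ∧ a.support = σ}.ncard := by
  rw [PowerSeries.coeff_prod]
  have h1 : ∀ a : V →₀ ℕ, (∏ v, PowerSeries.coeff (a v) (if v ∈ σ then
      (PowerSeries.mk fun i => if i = 0 then (0 : ℤ) else 1) else 1)) =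
      if a.support = σ then 1 else 0 := by
    intro a
    split_ifs with h
    · refine Finset.prod_eq_one fun v _ => ?_
      rw [← h]
      split_ifs with hv
      · rw [PowerSeries.coeff_mk, if_neg (Finsupp.mem_support_iff.1 hv)]
      · rw [Finsupp.notMem_support_iff.1 hv, PowerSeries.coeff_one, if_pos rfl]
    · obtain ⟨v, hv⟩ : ∃ v, ¬(v ∈ a.support ↔ v ∈ σ) := by
        by_contra! h'
        exact h (Finset.ext h')
      refine Finset.prod_eq_zero (Finset.mem_univ v) ?_
      split_ifs with hvσ
      · have : a v = 0 := by
          by_contra h0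
          exact hv ⟨fun _ => hvσ, fun _ => Finsupp.mem_support_iff.2 h0⟩
        rw [PowerSeries.coeff_mk, if_pos this]
      · have : a v ≠ 0 := fun h0 =>
          hv ⟨fun h' => absurd h0 (Finsupp.mem_support_iff.1 h'), fun h' => absurd h' hvσ⟩
        rw [PowerSeries.coeff_one, if_neg this]
  rw [Finset.sum_congr rfl fun a _ => h1 a, Finset.sum_boole,
    ← Set.ncard_coe_finset]
  congr 2
  ext a
  simp only [Finset.coe_filter, Finset.mem_finsuppAntidiag, Set.mem_ofPred_eq, Finset.subset_univ,
    and_true, Finsupp.degree_eq_sum]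

open Classical in
theorem mk_ncard_eq_sum (Ψ : RelComplex V) :
    (PowerSeries.mk fun j => ({a : V →₀ ℕ | a.degree = j ∧ a.support ∈ Ψ.faces}.ncard : ℤ)) =
      ∑ σ with σ ∈ Ψ.faces, ∏ v, if v ∈ σ then
        (PowerSeries.mk fun i => if i = 0 then (0 : ℤ) else 1) else 1 := by
  ext j
  rw [PowerSeries.coeff_mk, map_sum, Finset.sum_congr rfl fun σ _ => coeff_prod_support σ j,
    Set.ncard_eq_toFinset_card _ (finite_setOf_degree_eq _ _),
    Finset.card_eq_sum_card_fiberwise (f := Finsupp.support)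
      (t := Finset.univ.filter (· ∈ Ψ.faces))]
  · push_cast
    refine Finset.sum_congr rfl fun σ hσ => ?_
    rw [← Set.ncard_coe_finset]
    congr 2
    ext a
    have := (Finset.mem_filter.1 hσ).2
    simp only [Finset.coe_filter, Set.Finite.mem_toFinset, Set.mem_ofPred_eq]
    constructor
    · exact fun h => ⟨h.1.1, h.2⟩
    · exact fun h => ⟨⟨h.1, h.2 ▸ this⟩, h.2⟩
  · intro a ha
    simpa using ((Set.Finite.mem_toFinset _).1 ha).2

theorem one_sub_X_mul_mk :
    (1 - PowerSeries.X) * (PowerSeries.mk fun i => if i = 0 then (0 : ℤ) else 1) =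
      PowerSeries.X := by
  ext i
  rw [sub_mul, one_mul, map_sub, PowerSeries.coeff_X]
  obtain _ | i := i
  · simp
  · rw [mul_comm, PowerSeries.coeff_succ_mul_X, PowerSeries.coeff_mk, PowerSeries.coeff_mk]
    obtain _ | i := i <;> simp

/-- The Hilbert series of the face module, in terms of the `h`-vector. -/
theorem coeff_one_sub_X_pow_mul_mk_ncard (Ψ : RelComplex V) {n : ℕ}
    (h : ∀ σ ∈ Ψ.faces, σ.card ≤ n) (j : ℕ) :
    PowerSeries.coeff j ((1 - PowerSeries.X) ^ n * PowerSeries.mk fun j =>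
      ({a : V →₀ ℕ | a.degree = j ∧ a.support ∈ Ψ.faces}.ncard : ℤ)) = Ψ.hNum n j := by
  classical
  rw [RelComplex.hNum, ← Polynomial.coeff_coe, Ψ.hPoly_eq_sum h, mk_ncard_eq_sum, Finset.mul_sum]
  congr 1
  rw [← Polynomial.coeToPowerSeries.ringHom_apply, map_sum]
  refine Finset.sum_congr rfl fun σ hσ => ?_
  have hc := h σ (Finset.mem_filter.1 hσ).2
  rw [Finset.prod_ite_mem, Finset.univ_inter, Finset.prod_const]
  simp only [map_mul, map_pow, map_sub, map_one, Polynomial.coeToPowerSeries.ringHom_apply,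
    Polynomial.coe_X]
  -- Split `n` as `(n - |σ|) + |σ|`, so that each vertex of `σ` turns one factor `1 - x` into `x`.
  conv_lhs => rw [← Nat.sub_add_cancel hc]
  rw [pow_add, mul_assoc, ← mul_pow, one_sub_X_mul_mk, mul_comm]

end HVector

/-! ### Assembly of Schenzel's formula. -/

section Schenzel

open Module

attribute [local instance] MvPolynomial.gradedAlgebra

variable {V : Type*} {k : Type*} [Field k]

/-- Finiteness comes from embedding into the facet rings; minimality needs only one facet, of
cardinality `n`, and the height bound. -/
theorem isHSOP_of_forall_facet [Fintype V] (Ψ : RelComplex V) {n : ℕ} (hΨ : Ψ.IsPure n)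
    {Θ : List (MvPolynomial V k)} (hΘ : ∀ θ ∈ Θ, θ.IsHomogeneous 1) (hlen : Θ.length = n)
    (hgen : ∀ σ, Maximal (· ∈ Ψ.faces) σ → ∀ v, ∃ s ∈ Algebra.adjoin k {θ | θ ∈ Θ},
      (X v : MvPolynomial V k) - s ∈ facePrime k σ) :
    IsHSOP k (FaceModule k Ψ) Θ where
  homogeneous θ hθ := ⟨1, one_pos, hΘ θ hθ⟩
  finite := finite_quotientBy_of_forall_facet Ψ Θ hgen
  minimal Φ hΦ hfin := by
    obtain ⟨⟨σ, hσ⟩, hcard⟩ := hΨ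
    obtain ⟨ρ, hρ, -⟩ := Ψ.exists_facet hσ
    rw [hlen, ← hcard ρ hρ]
    exact card_le_length_of_finite_quotientBy Ψ hρ Φ hΦ hfin

theorem linearForms_length [Fintype V] (Δ : Complex V) (n : ℕ) (c : Fin n × Δ.Vertex → k) :
    (linearForms Δ n c).length = n := List.length_ofFn

theorem mem_span_X_of_mem_linearForms [Fintype V] {Δ : Complex V} {n : ℕ}
    {c : Fin n × Δ.Vertex → k} {θ : MvPolynomial V k} (hθ : θ ∈ linearForms Δ n c) :
    θ ∈ Submodule.span k (Set.range (X : V → MvPolynomial V k)) := by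
  obtain ⟨i, rfl⟩ := List.mem_ofFn.1 hθ
  refine sum_mem fun v _ => ?_
  rw [← smul_eq_C_mul]
  exact Submodule.smul_mem _ _ (Submodule.subset_span ⟨v.1, rfl⟩)

variable [LinearOrder V]

/-- A star without faces has zero face module. Any other star is pure with the same `n`, so the same
`Θ` is a system of parameters for its Cohen–Macaulay module. -/
theorem mem_relIdeal_star_of_mul_mem [Fintype V] {Ψ : RelComplex V} {n : ℕ}
    (hΨ : IsBuchsbaum k Ψ n) {Θ : List (MvPolynomial V k)} (hΘ : ∀ θ ∈ Θ, θ.IsHomogeneous 1)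
    (hlen : Θ.length = n)
    (hgen : ∀ σ, Maximal (· ∈ Ψ.faces) σ → ∀ v, ∃ s ∈ Algebra.adjoin k {θ | θ ∈ Θ},
      (X v : MvPolynomial V k) - s ∈ facePrime k σ)
    {i : ℕ} (hi : i < Θ.length) {τ : Finset V} (hτ : τ.Nonempty) {d : ℕ} {f : MvPolynomial V k}
    (hf : f ∈ nonfaceIdeal k (Ψ.Γ.star τ)) (hfd : f.IsHomogeneous d)
    (hmul : Θ[i] * f ∈ relIdeal k (Ψ.star τ) (Θ.take i)) :
    f ∈ relIdeal k (Ψ.star τ) (Θ.take i) := by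
  obtain hne | hne := (Ψ.star τ).faces.eq_empty_or_nonempty
  · refine Submodule.mem_sup_left (nonfaceIdeal_anti (fun σ hσ => ?_) hf)
    by_contra h
    exact Set.notMem_empty σ (hne ▸ ⟨hσ, h⟩)
  · obtain ⟨σ, hσ⟩ := hne
    have hτΔ : τ ∈ Ψ.Δ :=
      Ψ.Δ.lower Finset.subset_union_left (RelComplex.mem_faces_star.1 hσ).1
    have hpure : (Ψ.star τ).IsPure n :=
      ⟨⟨σ, hσ⟩, fun ρ hρ => hΨ.1.2 ρ (RelComplex.maximal_faces_of_star hρ)⟩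
    exact (isHSOP_of_forall_facet _ hpure hΘ hlen fun ρ hρ =>
      hgen ρ (RelComplex.maximal_faces_of_star hρ)).mem_relIdeal_of_mul_mem
        (hΨ.2 τ hτΔ hτ) i hi hf hfd hmul

theorem finrank_reducedDeg_eq [Fintype V] {Ψ : RelComplex V} {n : ℕ}
    (hΨ : IsBuchsbaum k Ψ n) {Θ : List (MvPolynomial V k)}
    (hΘ : ∀ θ ∈ Θ, θ ∈ Submodule.span k (Set.range (X : V → MvPolynomial V k)))
    (hlen : Θ.length = n)
    (hgen : ∀ σ, Maximal (· ∈ Ψ.faces) σ → ∀ v, ∃ s ∈ Algebra.adjoin k {θ | θ ∈ Θ},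
      (X v : MvPolynomial V k) - s ∈ facePrime k σ) (j : ℕ) :
    (finrank k (reducedDeg Ψ Θ j) : ℤ) = Ψ.hNum n j + n.choose j *
      ∑ i ∈ Finset.range (j - 1), (-1) ^ (i + j) * (finrank k (cohomology k Ψ i) : ℤ) := by
  have hΘ1 : ∀ θ ∈ Θ, θ.IsHomogeneous 1 := fun θ hθ => isHomogeneous_one_of_mem_span_X (hΘ θ hθ)
  let Xc : ℤ → ℤ → Submodule k (Finset V → MvPolynomial V k) :=
    polyCochains fun τ => nonfaceIdeal k (Ψ.Γ.star τ)
  let N : ℕ → ℤ → ℤ → Submodule k (Finset V → MvPolynomial V k) := fun r =>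
    polyCochains fun τ => relIdeal k (Ψ.star τ) (Θ.take r)
  -- The default value 0 only makes the parameters a total function of `r`; it is not reached for `r
  -- < n`.
  have hgetD : ∀ r (hr : r < n), Θ.getD r 0 = Θ[r] := fun r hr =>
    List.getD_eq_getElem _ _ _
  have hmem : ∀ r < n, Θ.getD r 0 ∈ Θ := fun r hr => by
    rw [hgetD r hr]
    exact List.getElem_mem _
  have hN0 : N 0 = polyCochains fun τ => nonfaceIdeal k (Ψ.Δ.star τ) := by
    refine congrArg polyCochains (funext fun τ => ?_)
    rw [List.take_zero, relIdeal_nil]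
    rfl
  have hrank : ∀ r : ℕ, ∀ m : ℤ, finrank k (N r 0 m) =
      finrank k (gradedPiece (relIdeal k Ψ (Θ.take r)) m) := fun r m => by
    rw [finrank_polyCochains_zero, RelComplex.star_empty]
  have hrankX : ∀ m : ℤ, finrank k (Xc 0 m) = finrank k (gradedPiece (nonfaceIdeal k Ψ.Γ) m) :=
    fun m => by rw [finrank_polyCochains_zero, Complex.star_empty]
  have hXneg : ∀ i j, j < 0 → Xc i j = ⊥ := fun i j => polyCochains_of_neg_right _ i
  have hNneg : ∀ r i j, j < 0 → N r i j = ⊥ := fun r i j => polyCochains_of_neg_right _ i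
  have main := (relBetti_and_finrank_of_isParameterStep (scalarCoboundary V k)
    (fun r => smulFamily (Θ.getD r 0)) Xc N n
    (fun r hr => isParameterStep_polyCochains Ψ (Θ.take r) (hΘ _ (hmem r hr))
      fun τ hτ d f hf hfd hmul => mem_relIdeal_star_of_mul_mem hΨ hΘ1 hlen hgen (hlen ▸ hr) hτ
        hf hfd (hgetD r hr ▸ hmul))
    (fun r hr i j => by
      have h := polyCochains_relIdeal_concat Ψ (Θ.take r)
        (fun θ hθ => ⟨1, hΘ1 θ (List.mem_of_mem_take hθ)⟩) (hΘ1 _ (hmem r hr)) i j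
      rwa [hgetD r hr, List.take_concat_get', ← hgetD r hr] at h)
    (fun j => polyCochains_of_neg_left _ (by norm_num) j)
    (fun r i j hj => by
      rw [relBetti, relCocycles, relCoboundaries, hXneg i j hj, hXneg (i - 1) j hj,
        hNneg r (i + 1) j hj, hNneg r i j hj,
        bot_inf_eq, Submodule.map_bot, sup_bot_eq, sub_self])
    (fun r j hj => by rw [hXneg _ _ hj, hNneg _ _ _ hj, sub_self])
    (fun i j _ hj => by rw [hN0]; exact relBetti_nonfaceIdeal_of_pos Ψ i hj)
    n le_rfl).2 j
  have hred := finrank_reducedDeg_add Ψ Θ j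
  have hcard : ∀ σ ∈ Ψ.faces, σ.card ≤ n := fun σ hσ => by
    obtain ⟨ρ, hρ, hle⟩ := Ψ.exists_facet hσ
    exact (Finset.card_le_card hle).trans (hΨ.1.2 ρ hρ).le
  have hH : (PowerSeries.mk fun m : ℕ => (finrank k (Xc 0 m) : ℤ) - finrank k (N 0 0 m)) =
      PowerSeries.mk fun m =>
        ({a : V →₀ ℕ | a.degree = m ∧ a.support ∈ Ψ.faces}.ncard : ℤ) := by
    refine congrArg PowerSeries.mk (funext fun m => ?_)
    rw [hrank, hrankX, List.take_zero, relIdeal_nil, finrank_gradedPiece_sub]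
  rw [hrank, hrankX, ← hlen, List.take_length, hlen, hH,
    coeff_one_sub_X_pow_mul_mk_ncard Ψ hcard, hN0, ← hred] at main
  rw [Nat.cast_add, add_sub_cancel_right] at main
  rw [main]
  congr 1
  obtain _ | j := j
  · simp
  -- Split off `m = 0`, which stands for `H^{-1}`, and reindex `m = i + 1`; this turns `range j`
  -- into `range (j - 1)`.
  rw [Finset.sum_range_succ', Nat.add_sub_cancel, mul_add]
  have h0 : (n.choose (j + 1) : ℤ) * ((-1) ^ (0 + 1 + (j + 1)) * relBetti (scalarCoboundary V k) Xc
      (polyCochains fun τ => nonfaceIdeal k (Ψ.Δ.star τ)) (0 : ℕ) 0) = 0 := by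
    -- For `n = 0` there may be no vertex and `H^{-1}` may survive, but then its binomial
    -- coefficient is zero.
    obtain hn | hn := Nat.eq_zero_or_pos n
    · rw [hn, Nat.choose_zero_succ, Nat.cast_zero, zero_mul]
    · obtain ⟨σ, hσ⟩ := hΨ.1.1
      obtain ⟨ρ, hρ, -⟩ := Ψ.exists_facet hσ
      obtain ⟨v, hv⟩ : ρ.Nonempty := Finset.card_pos.1 (hΨ.1.2 ρ hρ ▸ hn)
      have h1 := relBetti_nonfaceIdeal_zero_zero (k := k) Ψ
        (Ψ.Δ.lower (Finset.singleton_subset_iff.2 hv) hρ.1.1)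
      rw [Nat.cast_zero, h1, mul_zero, mul_zero]
  rw [h0, add_zero]
  congr 1
  refine Finset.sum_congr rfl fun i _ => ?_
  rw [relBetti_nonfaceIdeal_zero]
  ring

end Schenzel

end StanleyReisner

theorem mainTheorem4 {k : Type*} [Field k] [Infinite k] {V : Type*} [Fintype V] [LinearOrder V]
    (Ψ : StanleyReisner.RelComplex V) (n : ℕ) (hΨ : StanleyReisner.IsBuchsbaum k Ψ n) :
    StanleyReisner.ForGeneric k Ψ.Δ n fun Θ =>
      StanleyReisner.IsLSOP k (StanleyReisner.FaceModule k Ψ) Θ ∧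
      ∀ j : ℕ,
        (Module.finrank k (StanleyReisner.reducedDeg Ψ Θ j) : ℤ) =
          Ψ.hNum n j + (n.choose j : ℤ) *
            ∑ i ∈ Finset.range (j - 1),
              (-1 : ℤ) ^ (i + j) * (Module.finrank k (StanleyReisner.cohomology k Ψ i) : ℤ) := by
  obtain ⟨p, hp, hgen⟩ := StanleyReisner.exists_generic_linearForms (k := k) Ψ n hΨ.1.2
  refine ⟨p, hp, fun c hc => ?_⟩
  have hspan := fun θ => StanleyReisner.mem_span_X_of_mem_linearForms (c := c) (θ := θ)
  have hlen := StanleyReisner.linearForms_length Ψ.Δ n c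
  have h1 := fun θ hθ => StanleyReisner.isHomogeneous_one_of_mem_span_X (hspan θ hθ)
  exact ⟨⟨StanleyReisner.isHSOP_of_forall_facet Ψ hΨ.1 h1 hlen (hgen c hc), h1⟩,
    StanleyReisner.finrank_reducedDeg_eq hΨ hspan hlen (hgen c hc)⟩

end
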